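/- Let $(A_n,B_n)_{n\ge 1}$ be i.i.d. random vectors in $\mathbb R^2$ with generic copy $(A,B)$, and assume $\mathbb P(A<0)>0$. Put $\Pi_0=1$, $\Pi_n=A_1\cdots A_n$, $R_n^*=\sum_{k=1}^n\Pi_{k-1}B_k$, and $N=\inf\{n\ge 1:\Pi_n\ge 0\}$. Write $a_+=\max\{a,0\}$, $a_-=\max\{-a,0\}$. Then $N<\infty$ almost surely, and the following hold. (i) There is exactly one probability law for $S$ such that $S\overset{d}{=}A_+S+B$ with $S$ independent of $(A,B)$. For $S$ with this law and independent of $(A,B)$, $$R_N^*\overset{d}{=}(-A_-)S+B .$$ (ii) Let $\alpha>0$, let $p,q\ge 0$ with $p+q=1$, and let $L:(0,\infty)\to(0,\infty)$ be a slowly varying function, i.e. measurable with $L(\lambda x)/L(x)\to 1$ as $x\to\infty$ for every $\lambda>0$. Suppose that, as $t\to\infty$, $$\frac{\mathbb P(B>t)}{t^{-\alpha}L(t)}\to p,\qquad \frac{\mathbb P(B<-t)}{t^{-\alpha}L(t)}\to q ,$$ that $\mathbb E|A|^{\alpha+\varepsilon}<\infty$ for some $\varepsilon>0$, and that $\mu_+:=\mathbb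 E\big[A^{\alpha}\mathbf 1_{\{A>0\}}\big]<1$. Then, as $t\to\infty$, $$\frac{\mathbb P(S>t)}{t^{-\alpha}L(t)}\to\frac{p}{1-\mu_+},\qquad \frac{\mathbb P(S<-t)}{t^{-\alpha}L(t)}\to\frac{q}{1-\mu_+};$$ in particular $\mathbb P(S>t)\sim\frac{1}{1-\mu_+}\mathbb P(B>t)$ if $p>0$, and $\mathbb P(S<-t)\sim\frac{1}{1-\mu_+}\mathbb P(B<-t)$ if $q>0$. If moreover $\mathbb E|A|^\alpha=1$, then, for all such $p,q$ (including $p=0$ or $q=0$), $$\mathbb P(R_N^*>t)\sim\mathbb P(|B|>t)\sim\mathbb P(R_N^*<-t)\qquad (t\to\infty).$$ Here $f\sim g$ means $f(t)/g(t)\to1$ as $t\to\infty$. -/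

import Mathlib

open MeasureTheory ProbabilityTheory Filter Topology Asymptotics

/-- A measurable function `f : (0,∞) → (0,∞)` (values outside `(0,∞)` are ignored) is regularly
varying with index `ρ` if `f (l x) / f x → l ^ ρ` as `x → ∞`, for every `l > 0`. -/
structure RegVarying (f : ℝ → ℝ) (ρ : ℝ) : Prop where
  measurable_restrict : Measurable (fun x : Set.Ioi (0 : ℝ) => f x)
  pos : ∀ x, 0 < x → 0 < f x
  tendsto : ∀ l, 0 < l → Tendsto (fun x => f (l * x) / f x) atTop (𝓝 (l ^ ρ))

/-- Slowly varying means regularly varying with index `0`. -/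
def SlowlyVarying (f : ℝ → ℝ) : Prop := RegVarying f 0

section Stopped

variable {Ω : Type*}

/-- The product `Π_n = A_1 ⋯ A_n`, with `Π_0 = 1`. The sequences are indexed from `0` here, so that
`A k` is the variable called `A_{k+1}` in the usual notation. -/
def prodA (A : ℕ → Ω → ℝ) (n : ℕ) (ω : Ω) : ℝ := ∏ k ∈ Finset.range n, A k ω

/-- `R_n^* = B_1 + A_1 B_2 + ⋯ + A_1 ⋯ A_{n-1} B_n`. -/
def partialSum (A B : ℕ → Ω → ℝ) (n : ℕ) (ω : Ω) : ℝ :=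
  ∑ k ∈ Finset.range n, prodA A k ω * B k ω

/-- `N = inf {n ≥ 1 : Π_n ≥ 0}` (with the irrelevant value `0` where no such `n` exists). -/
noncomputable def stopN (A : ℕ → Ω → ℝ) (ω : Ω) : ℕ := sInf {n : ℕ | 1 ≤ n ∧ 0 ≤ prodA A n ω}

/-- The stopped sum `R_N^*`. -/
noncomputable def stoppedSum (A B : ℕ → Ω → ℝ) (ω : Ω) : ℝ := partialSum A B (stopN A ω) ω

end Stopped

/-- The law of `a₊ S + b`, where `(a, b)` has law `μ`, `S` has law `ν`, and the two are
independent; here `a₊ = max a 0`. -/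
noncomputable def lawPos (μ : Measure (ℝ × ℝ)) (ν : Measure ℝ) : Measure ℝ :=
  (μ.prod ν).map (fun z : (ℝ × ℝ) × ℝ => max z.1.1 0 * z.2 + z.1.2)

/-- The law of `(-a₋) S + b`, where `(a, b)` has law `μ`, `S` has law `ν`, and the two are
independent; here `a₋ = max (-a) 0`. -/
noncomputable def lawNeg (μ : Measure (ℝ × ℝ)) (ν : Measure ℝ) : Measure ℝ :=
  (μ.prod ν).map (fun z : (ℝ × ℝ) × ℝ => -(max (-z.1.1) 0) * z.2 + z.1.2)

/-- `ν` is the law of a solution `S` of `S =ᵈ a₊ S + b`, with `S` independent of `(a, b) ∼ μ`. -/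
def IsSolutionLaw (μ : Measure (ℝ × ℝ)) (ν : Measure ℝ) : Prop :=
  IsProbabilityMeasure ν ∧ lawPos μ ν = ν

/-- `μ₊ = E[A^α 1{A > 0}]`. -/
noncomputable def muPlus {Ω : Type*} [MeasurableSpace Ω] (P : Measure Ω) (A : Ω → ℝ) (α : ℝ) : ℝ :=
  ∫ ω in {ω | 0 < A ω}, (A ω) ^ α ∂P

/-!
The key to the stopped sum is that the products `A₁ ⋯ A_n` can become nonnegative in two ways only:
at once, if `A₁ ≥ 0`, or at the first nonpositive factor after a negative `A₁`. Up to that time the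
later factors are positive, so the sum collected after `A₁` is the perpetuity
`S = B₂ + A₂⁺ B₃ + A₂⁺ A₃⁺ B₄ + ⋯`, which breaks off at the first nonpositive factor
(`stoppedSum_eq`). It is independent of `(A₁, B₁)`, and its law solves `S = A₊ S + B`
(`perpetuity_eq`, `exists_isSolutionLaw_and_map_stoppedSum`); this gives existence and the identity
for the law of the stopped sum. There is only one solution, because the map `ν ↦ lawPos μ ν`
contracts the total variation distance by the factor `P(A > 0) < 1` (`IsSolutionLaw.unique`).

For the tails, `t ^ (-α) L(t)` is replaced by the equivalent function `G(t) = P(|B| > t)`. Being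
monotone, it admits Potter bounds with an elementary proof (`IsRegTail.potter`), and these provide
the dominating functions for everything that follows. If `X` is independent of `(U, V)`, with
`U ≥ 0`, and has tails of order `G`, then `U X + V` is large when exactly one of its summands is
large, while both are large with probability `o(G)` (`tendsto_joint_tail`). Hence the tail constants
of `U X` and `V` add up, also in the form of one-sided eventual bounds (`eventually_step_le`,
`eventually_le_step`).

Applied to the equation `S = A₊ S + B`, a bound `c G` for the tail of `S` improves to
`(μ₊ c + p + η) G`, and iteration drives both bounds to the fixed point `p / (1 - μ₊)`
(`tendsto_tail_of_fixedPoint`). The iteration has to start from some finite bound, which is found by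
comparison (`exists_tail_le_of_fixedPoint`): a large multiple of `|B|`, conditioned on being large,
satisfies the inequality opposite to that of `|S|`, and the contraction by `P(A > 0)` shows that it
dominates `|S|` stochastically. Left tails are right tails of `-S`. One more step, from `S` to
`-A₋ S + B`, gives the tails of the stopped sum; when `E|A| ^ α = 1` the constants are
`q E[A₋ ^ α] / (1 - μ₊) + p = q + p = 1` on the right and likewise on the left.
-/

/-! ### Regularly varying tail functions -/

/-- A tail function, that is a positive antitone function on the line, which is regularly varying
with index `-α`. -/
structure IsRegTail (G : ℝ → ℝ) (α : ℝ) : Prop where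
  antitone : Antitone G
  pos : ∀ t, 0 < G t
  tendsto : ∀ l, 0 < l → Tendsto (fun t => G (l * t) / G t) atTop (𝓝 (l ^ (-α)))

namespace IsRegTail

variable {G : ℝ → ℝ} {α β : ℝ}

/-- The lower Potter bound along an unbounded range: beyond some point, enlarging the argument by
a factor `a ≥ 1` costs at most a factor of order `a ^ β`. Because `G` is monotone it is enough to
iterate the estimate for `a = 2`. -/
lemma exists_le_rpow_mul (hG : IsRegTail G α) (hαβ : α < β) (hβ : 0 ≤ β) :
    ∃ x₀ : ℝ, 0 < x₀ ∧ ∀ s, x₀ ≤ s → ∀ a, 1 ≤ a → G s ≤ 2 ^ β * a ^ β * G (a * s) := by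
  have h2 : (2 : ℝ) ^ (-β) < 2 ^ (-α) :=
    Real.rpow_lt_rpow_of_exponent_lt (by norm_num) (by linarith)
  obtain ⟨x₁, hx₁⟩ := eventually_atTop.1 ((hG.tendsto 2 two_pos).eventually (lt_mem_nhds h2))
  have hdouble : ∀ t, max x₁ 1 ≤ t → 2 ^ (-β) * G t ≤ G (2 * t) := fun t ht =>
    ((lt_div_iff₀ (hG.pos t)).1 (hx₁ t (le_trans (le_max_left _ _) ht))).le
  have hpow : ∀ n : ℕ, ∀ t, max x₁ 1 ≤ t → ((2 : ℝ) ^ (-β)) ^ n * G t ≤ G (2 ^ n * t) := by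
    intro n
    induction n with
    | zero => intro t _; simp
    | succ n ih =>
      intro t ht
      have h1 : (1 : ℝ) ≤ 2 ^ n := one_le_pow₀ (by norm_num)
      have ht0 : 0 < t := lt_of_lt_of_le one_pos (le_trans (le_max_right _ _) ht)
      have h3 := hdouble (2 ^ n * t) (le_trans ht (le_mul_of_one_le_left ht0.le h1))
      calc ((2 : ℝ) ^ (-β)) ^ (n + 1) * G t = 2 ^ (-β) * (((2 : ℝ) ^ (-β)) ^ n * G t) := by ring
        _ ≤ 2 ^ (-β) * G (2 ^ n * t) := by gcongr; exact ih t ht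
        _ ≤ _ := by convert h3 using 2; ring
  refine ⟨max x₁ 1, lt_of_lt_of_le one_pos (le_max_right _ _), fun s hs a ha => ?_⟩
  have hs0 : 0 < s := lt_of_lt_of_le one_pos (le_trans (le_max_right _ _) hs)
  obtain ⟨n, hn1, hn2⟩ := exists_nat_pow_near ha (one_lt_two : (1 : ℝ) < 2)
  have h4 : ((2 : ℝ) ^ (-β)) ^ (n + 1) * G s ≤ G (a * s) :=
    (hpow (n + 1) s hs).trans (hG.antitone (by gcongr))
  have h5 : (2 : ℝ) ^ β * a ^ β * ((2 : ℝ) ^ (-β)) ^ (n + 1) ≥ 1 := by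
    have h6 : ((2 : ℝ) ^ (-β)) ^ (n + 1) = ((2 : ℝ) ^ β)⁻¹ * (((2 : ℝ) ^ n) ^ β)⁻¹ := by
      rw [Real.rpow_neg (by norm_num), pow_succ, inv_pow, mul_comm, ← Real.rpow_natCast,
        ← Real.rpow_mul (by norm_num), mul_comm β, Real.rpow_mul (by norm_num), Real.rpow_natCast]
    have h7 : ((2 : ℝ) ^ n) ^ β ≤ a ^ β := Real.rpow_le_rpow (by positivity) hn1 hβ
    have h8 : 0 < ((2 : ℝ) ^ n) ^ β := by positivity
    have h9 : 0 < (2 : ℝ) ^ β := by positivity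
    rw [h6]
    calc (1 : ℝ) ≤ a ^ β / ((2 : ℝ) ^ n) ^ β := (one_le_div h8).2 h7
      _ = _ := by field_simp
  calc G s ≤ (2 ^ β * a ^ β * ((2 : ℝ) ^ (-β)) ^ (n + 1)) * G s :=
        le_mul_of_one_le_left (hG.pos s).le h5
    _ = 2 ^ β * a ^ β * (((2 : ℝ) ^ (-β)) ^ (n + 1) * G s) := by ring
    _ ≤ _ := by gcongr

/-- A Potter bound that holds uniformly on `(0, ∞)`, as is possible because `G` is bounded there
and bounded away from `0` on bounded sets. -/
lemma potter (hG : IsRegTail G α) (hαβ : α < β) (hβ : 0 ≤ β) :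
    ∃ K : ℝ, 0 < K ∧ ∀ t, 0 < t → ∀ a, 0 < a → G (t / a) ≤ K * (1 + a ^ β) * G t := by
  obtain ⟨x₀, hx₀, h⟩ := hG.exists_le_rpow_mul hαβ hβ
  set D := G 0 / G x₀ with hD
  have hD1 : 1 ≤ D := (one_le_div (hG.pos _)).2 (hG.antitone hx₀.le)
  have h21 : (1 : ℝ) ≤ 2 ^ β := Real.one_le_rpow (by norm_num) hβ
  have hK1 : 1 ≤ 2 ^ β * D := by nlinarith
  have hG0 : G 0 = D * G x₀ := by rw [hD, div_mul_cancel₀ _ (hG.pos x₀).ne']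
  refine ⟨2 ^ β * D, by positivity, fun t ht a ha => ?_⟩
  have hab : 0 < a ^ β := by positivity
  have hGt := hG.pos t
  have hsmall : ∀ y, y ≤ 2 ^ β * D * G t → y ≤ 2 ^ β * D * (1 + a ^ β) * G t := by
    intro y hy
    have : 0 ≤ 2 ^ β * D * a ^ β * G t := by positivity
    nlinarith
  have hlarge : ∀ y, y ≤ 2 ^ β * D * a ^ β * G t → y ≤ 2 ^ β * D * (1 + a ^ β) * G t := by
    intro y hy
    have : 0 ≤ 2 ^ β * D * G t := by positivity
    nlinarith
  rcases le_total a 1 with ha1 | ha1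
  · refine hsmall _ ((hG.antitone ?_).trans (le_mul_of_one_le_left hGt.le hK1))
    exact (le_div_iff₀ ha).2 (mul_le_of_le_one_right ht.le ha1)
  rcases le_total x₀ (t / a) with h1 | h1
  · refine hlarge _ ((h (t / a) h1 a ha1).trans ?_)
    rw [mul_div_cancel₀ _ ha.ne']
    have : 2 ^ β * a ^ β * G t ≤ D * (2 ^ β * a ^ β * G t) :=
      le_mul_of_one_le_left (by positivity) hD1
    nlinarith
  · have h2 : G (t / a) ≤ D * G x₀ := hG0 ▸ hG.antitone (by positivity)
    rcases le_total t x₀ with h3 | h3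
    · refine hsmall _ (h2.trans ?_)
      have h4 : D * G x₀ ≤ D * G 0 := by gcongr; exact hG.antitone hx₀.le
      have h5 : G x₀ ≤ G t := hG.antitone h3
      calc D * G x₀ ≤ D * G t := by gcongr
        _ ≤ 2 ^ β * (D * G t) := le_mul_of_one_le_left (by positivity) h21
        _ = _ := by ring
    · refine hlarge _ (h2.trans ?_)
      have h4 := h x₀ le_rfl (t / x₀) ((one_le_div hx₀).2 h3)
      rw [div_mul_cancel₀ _ hx₀.ne'] at h4
      have h5 : (t / x₀) ^ β ≤ a ^ β := by
        refine Real.rpow_le_rpow (by positivity) ?_ hβ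
        rw [div_le_iff₀ hx₀]
        rw [div_le_iff₀ ha] at h1
        linarith
      calc D * G x₀ ≤ D * (2 ^ β * (t / x₀) ^ β * G t) := by gcongr
        _ ≤ D * (2 ^ β * a ^ β * G t) := by gcongr
        _ = _ := by ring

lemma tendsto_div (hG : IsRegTail G α) {u : ℝ} (hu : 0 < u) :
    Tendsto (fun t => G (t / u) / G t) atTop (𝓝 (u ^ α)) := by
  have := hG.tendsto u⁻¹ (inv_pos.2 hu)
  rw [Real.inv_rpow hu.le, Real.rpow_neg hu.le, inv_inv] at this
  refine this.congr fun t => ?_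
  rw [div_eq_inv_mul t u]

/-- A slight decrease of the argument changes `G` by a factor close to one. -/
lemma exists_shrink_le (hG : IsRegTail G α) {η : ℝ} (hη : 0 < η) :
    ∃ δ, 0 < δ ∧ δ < 1 ∧ ∀ᶠ t in atTop, G ((1 - δ) * t) ≤ (1 + η) * G t := by
  have hc : Tendsto (fun δ : ℝ => (1 - δ) ^ (-α)) (𝓝[>] 0) (𝓝 1) := by
    have : ContinuousAt (fun δ : ℝ => (1 - δ) ^ (-α)) 0 :=
      ContinuousAt.rpow_const (by fun_prop) (by simp)
    have h := this.tendsto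
    simp only [sub_zero, Real.one_rpow] at h
    exact h.mono_left nhdsWithin_le_nhds
  have h1 := hc.eventually (gt_mem_nhds (show (1 : ℝ) < 1 + η by linarith))
  have h2 : ∀ᶠ δ : ℝ in 𝓝[>] 0, δ ∈ Set.Ioo (0 : ℝ) 1 := Ioo_mem_nhdsGT one_pos
  obtain ⟨δ, hδ1, hδ0, hδ2⟩ := (h1.and h2).exists
  refine ⟨δ, hδ0, hδ2, ?_⟩
  filter_upwards [(hG.tendsto (1 - δ) (by linarith)).eventually (gt_mem_nhds hδ1)] with t ht
  exact ((div_lt_iff₀ (hG.pos t)).1 ht).le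

/-- A slight increase of the argument changes `G` by a factor close to one. -/
lemma exists_le_stretch (hG : IsRegTail G α) {η : ℝ} (hη : 0 < η) :
    ∃ δ, 0 < δ ∧ ∀ᶠ t in atTop, (1 - η) * G t ≤ G ((1 + δ) * t) := by
  have hc : Tendsto (fun δ : ℝ => (1 + δ) ^ (-α)) (𝓝[>] 0) (𝓝 1) := by
    have : ContinuousAt (fun δ : ℝ => (1 + δ) ^ (-α)) 0 :=
      ContinuousAt.rpow_const (by fun_prop) (by simp)
    have h := this.tendsto
    simp only [add_zero, Real.one_rpow] at h
    exact h.mono_left nhdsWithin_le_nhds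
  have h1 := hc.eventually (lt_mem_nhds (show 1 - η < (1 : ℝ) by linarith))
  obtain ⟨δ, hδ1, hδ0⟩ := (h1.and self_mem_nhdsWithin).exists
  have hδ0 : 0 < δ := hδ0
  refine ⟨δ, hδ0, ?_⟩
  filter_upwards [(hG.tendsto (1 + δ) (by linarith)).eventually (lt_mem_nhds hδ1)] with t ht
  exact ((lt_div_iff₀ (hG.pos t)).1 ht).le

end IsRegTail

/-! ### One big jump for `U X + V` -/

section Product

variable {Ω : Type*} [MeasurableSpace Ω] {P : Measure Ω} {U V : Ω → ℝ}

lemma measureReal_prod_eq_integral {X : Type*} [MeasurableSpace X] (ν : Measure X)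
    [IsProbabilityMeasure ν] {s : Set (Ω × X)} (hs : MeasurableSet s) :
    (P.prod ν).real s = ∫ ω, ν.real (Prod.mk ω ⁻¹' s) ∂P := by
  simp only [measureReal_def]
  rw [Measure.prod_apply hs, integral_toReal (measurable_measure_prodMk_left hs).aemeasurable
    (ae_of_all _ fun _ => measure_lt_top _ _)]

lemma measurableSet_lt_mul (hU : Measurable U) (s : ℝ) :
    MeasurableSet {z : Ω × ℝ | s < U z.1 * z.2} :=
  measurableSet_lt measurable_const ((hU.comp measurable_fst).mul measurable_snd)

lemma measurableSet_lt_mul_abs (hU : Measurable U) (s : ℝ) :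
    MeasurableSet {z : Ω × ℝ | s < U z.1 * |z.2|} :=
  measurableSet_lt measurable_const ((hU.comp measurable_fst).mul measurable_snd.abs)

lemma measurableSet_lt_mul_add (hU : Measurable U) (hV : Measurable V) (s : ℝ) :
    MeasurableSet {z : Ω × ℝ | s < U z.1 * z.2 + V z.1} :=
  measurableSet_lt measurable_const
    (((hU.comp measurable_fst).mul measurable_snd).add (hV.comp measurable_fst))

/-- The tail of the product `U X` with `X ∼ ν` independent of `U`, by conditioning on `U`. -/
lemma measureReal_lt_mul (ν : Measure ℝ) [IsProbabilityMeasure ν] (hU : Measurable U)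
    (hU0 : ∀ ω, 0 ≤ U ω) {t : ℝ} (ht : 0 < t) :
    (P.prod ν).real {z | t < U z.1 * z.2} =
      ∫ ω, (if 0 < U ω then ν.real (Set.Ioi (t / U ω)) else 0) ∂P := by
  rw [measureReal_prod_eq_integral ν (measurableSet_lt_mul hU t)]
  refine integral_congr_ae (ae_of_all _ fun ω => ?_)
  dsimp only
  split_ifs with h
  · congr 1
    ext x
    simp [div_lt_iff₀ h, mul_comm]
  · have h0 : U ω = 0 := le_antisymm (not_lt.1 h) (hU0 ω)
    have : Prod.mk ω ⁻¹' {z : Ω × ℝ | t < U z.1 * z.2} = ∅ := by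
      ext x
      simp [h0, ht.le]
    rw [this, measureReal_empty]

end Product

section OneStep

variable {Ω : Type*} [MeasurableSpace Ω] {P : Measure Ω} [IsProbabilityMeasure P]
  {ν : Measure ℝ} [IsProbabilityMeasure ν] {U V : Ω → ℝ} {G : ℝ → ℝ} {α β : ℝ}

lemma integrable_measureReal_section {X : Type*} [MeasurableSpace X] (ν : Measure X)
    [IsProbabilityMeasure ν] {s : Set (Ω × X)} (hs : MeasurableSet s) :
    Integrable (fun ω => ν.real (Prod.mk ω ⁻¹' s)) P := by
  refine Integrable.of_bound (C := 1)
    (measurable_measure_prodMk_left hs).ennreal_toReal.aestronglyMeasurable ?_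
  exact ae_of_all _ fun ω => by
    rw [Real.norm_of_nonneg measureReal_nonneg]; exact measureReal_le_one

/-- A Potter-dominated form of Breiman's lemma: if `Φ` is asymptotic to `c G` and globally
dominated by `G`, then `E[Φ(t / U); U > 0]` is asymptotic to `c E[U ^ α] G(t)`. -/
lemma tendsto_integral_div_regTail (hG : IsRegTail G α) (hα : 0 < α) (hαβ : α < β)
    (hU : Measurable U) (hU0 : ∀ ω, 0 ≤ U ω) (hUβ : Integrable (fun ω => U ω ^ β) P)
    {Φ : ℝ → ℝ} (hΦ : Measurable Φ) {C c : ℝ} (hC : ∀ s, |Φ s| ≤ C * G s)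
    (hc : Tendsto (fun s => Φ s / G s) atTop (𝓝 c)) :
    Tendsto (fun t => (∫ ω, (if 0 < U ω then Φ (t / U ω) else 0) ∂P) / G t) atTop
      (𝓝 (c * ∫ ω, U ω ^ α ∂P)) := by
  obtain ⟨K, hK, hpot⟩ := hG.potter hαβ (by linarith)
  have hC0 : 0 ≤ C := by
    have := (abs_nonneg _).trans (hC 0)
    exact nonneg_of_mul_nonneg_left this (hG.pos 0)
  simp_rw [← integral_div, ← integral_const_mul]
  refine tendsto_integral_filter_of_dominated_convergence
    (fun ω => C * (K * (1 + U ω ^ β))) ?_ ?_ ?_ ?_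
  · refine Eventually.of_forall fun t => Measurable.aestronglyMeasurable ?_
    exact (Measurable.ite (measurableSet_lt measurable_const hU)
      (hΦ.comp (measurable_const.div hU)) measurable_const).div_const _
  · filter_upwards [eventually_gt_atTop 0] with t ht
    refine ae_of_all _ fun ω => ?_
    have hGt := hG.pos t
    have hβ0 : 0 ≤ U ω ^ β := Real.rpow_nonneg (hU0 ω) _
    rw [norm_div, Real.norm_of_nonneg hGt.le, div_le_iff₀ hGt]
    split_ifs with h
    · rw [Real.norm_eq_abs]
      calc |Φ (t / U ω)| ≤ C * G (t / U ω) := hC _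
        _ ≤ C * (K * (1 + U ω ^ β) * G t) := by gcongr; exact hpot t ht _ h
        _ = _ := by ring
    · rw [norm_zero]; positivity
  · exact (((integrable_const 1).add hUβ).const_mul K).const_mul C
  · refine ae_of_all _ fun ω => ?_
    by_cases h : 0 < U ω
    · simp only [h, if_true]
      have h1 : Tendsto (fun t => Φ (t / U ω) / G (t / U ω)) atTop (𝓝 c) :=
        hc.comp (tendsto_id.atTop_div_const h)
      refine (h1.mul (hG.tendsto_div h)).congr fun t => ?_
      have := (hG.pos (t / U ω)).ne'
      field_simp
    · have h0 : U ω = 0 := le_antisymm (not_lt.1 h) (hU0 ω)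
      simp [h0, Real.zero_rpow hα.ne']

lemma integrable_regTail_div (hG : IsRegTail G α) (hα : 0 < α) (hαβ : α < β)
    (hU : Measurable U) (hU0 : ∀ ω, 0 ≤ U ω) (hUβ : Integrable (fun ω => U ω ^ β) P)
    {Φ : ℝ → ℝ} (hΦ : Measurable Φ) {C : ℝ} (hC : ∀ s, |Φ s| ≤ C * G s) {t : ℝ} (ht : 0 < t) :
    Integrable (fun ω => if 0 < U ω then Φ (t / U ω) else 0) P := by
  obtain ⟨K, hK, hpot⟩ := hG.potter hαβ (by linarith)
  have hC0 : 0 ≤ C := nonneg_of_mul_nonneg_left ((abs_nonneg _).trans (hC 0)) (hG.pos 0)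
  refine Integrable.mono' (((((integrable_const 1).add hUβ).const_mul K).mul_const
    (G t)).const_mul C) ?_ (ae_of_all _ fun ω => ?_)
  · exact (Measurable.ite (measurableSet_lt measurable_const hU)
      (hΦ.comp (measurable_const.div hU)) measurable_const).aestronglyMeasurable
  · have hβ0 : 0 ≤ U ω ^ β := Real.rpow_nonneg (hU0 ω) _
    have hGt := hG.pos t
    split_ifs with h
    · exact (hC _).trans (mul_le_mul_of_nonneg_left (hpot t ht _ h) hC0)
    · simp only [norm_zero, Pi.add_apply]; positivity

lemma antitone_measureReal_Ioi (ν : Measure ℝ) [IsProbabilityMeasure ν] :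
    Antitone fun t => ν.real (Set.Ioi t) := fun _ _ h =>
  measureReal_mono (Set.Ioi_subset_Ioi h)

lemma measureReal_Ioi_le_abs (ν : Measure ℝ) [IsProbabilityMeasure ν] (s : ℝ) :
    ν.real (Set.Ioi s) ≤ ν.real {x | s < |x|} :=
  measureReal_mono fun x (hx : s < x) => hx.trans_le (le_abs_self x)

/-- If the tail of `X` is eventually at most `c G`, then that of `U X` is eventually at most
`(c E[U ^ α] + η) G`. The tail of `X` need not have an exact asymptotic constant: the limit theorem
is applied to its maximum with `c G`, which has one. -/
lemma eventually_prod_tail_le (hG : IsRegTail G α) (hα : 0 < α) (hαβ : α < β)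
    (hU : Measurable U) (hU0 : ∀ ω, 0 ≤ U ω) (hUβ : Integrable (fun ω => U ω ^ β) P)
    {C c η : ℝ} (hη : 0 < η) (hC : ∀ s, ν.real {x | s < |x|} ≤ C * G s)
    (hc : ∀ᶠ s in atTop, ν.real (Set.Ioi s) ≤ c * G s) :
    ∀ᶠ t in atTop, (P.prod ν).real {z | t < U z.1 * z.2} ≤ (c * ∫ ω, U ω ^ α ∂P + η) * G t := by
  have hmeas : Measurable fun s => ν.real (Set.Ioi s) := (antitone_measureReal_Ioi ν).measurable
  have hC' := fun s => (measureReal_Ioi_le_abs ν s).trans (hC s)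
  set Φ : ℝ → ℝ := fun s => max (ν.real (Set.Ioi s)) (c * G s) with hΦ
  have hΦm : Measurable Φ := hmeas.max (hG.antitone.measurable.const_mul c)
  have hlim : Tendsto (fun s => Φ s / G s) atTop (𝓝 c) := by
    refine tendsto_const_nhds.congr' ?_
    filter_upwards [hc] with s hs
    rw [hΦ, eq_div_iff (hG.pos s).ne']
    simp only [max_eq_right hs]
  have hbd : ∀ s, |Φ s| ≤ max C |c| * G s := by
    intro s
    have hGs := hG.pos s
    have h1 : C * G s ≤ max C |c| * G s := by gcongr; exact le_max_left _ _
    have h2 : |c| * G s ≤ max C |c| * G s := by gcongr; exact le_max_right _ _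
    have h3 : c * G s ≤ |c| * G s := by gcongr; exact le_abs_self c
    have h0 : 0 ≤ Φ s := le_max_of_le_left measureReal_nonneg
    rw [abs_of_nonneg h0]
    exact max_le ((hC' s).trans h1) (h3.trans h2)
  have := tendsto_integral_div_regTail hG hα hαβ hU hU0 hUβ hΦm hbd hlim
  filter_upwards [this.eventually (gt_mem_nhds (lt_add_of_pos_right _ hη)),
    eventually_gt_atTop 0] with t ht ht0
  have h4 := (div_lt_iff₀ (hG.pos t)).1 ht
  rw [measureReal_lt_mul ν hU hU0 ht0]
  refine le_trans (integral_mono_of_nonneg ?_ ?_ ?_) h4.le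
  · refine ae_of_all _ fun ω => ?_
    dsimp only; split_ifs
    · exact measureReal_nonneg
    · exact le_rfl
  · exact integrable_regTail_div hG hα hαβ hU hU0 hUβ hΦm hbd ht0
  · refine ae_of_all _ fun ω => ?_
    dsimp only; split_ifs
    · exact le_max_left _ _
    · exact le_rfl

/-- The counterpart of `eventually_prod_tail_le` for lower bounds, with a minimum in place of the
maximum. -/
lemma eventually_le_prod_tail (hG : IsRegTail G α) (hα : 0 < α) (hαβ : α < β)
    (hU : Measurable U) (hU0 : ∀ ω, 0 ≤ U ω) (hUβ : Integrable (fun ω => U ω ^ β) P)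
    {C c η : ℝ} (hη : 0 < η) (hC : ∀ s, ν.real {x | s < |x|} ≤ C * G s)
    (hc : ∀ᶠ s in atTop, c * G s ≤ ν.real (Set.Ioi s)) :
    ∀ᶠ t in atTop, (c * ∫ ω, U ω ^ α ∂P - η) * G t ≤ (P.prod ν).real {z | t < U z.1 * z.2} := by
  have hmeas : Measurable fun s => ν.real (Set.Ioi s) := (antitone_measureReal_Ioi ν).measurable
  have hC' := fun s => (measureReal_Ioi_le_abs ν s).trans (hC s)
  set Φ : ℝ → ℝ := fun s => min (ν.real (Set.Ioi s)) (c * G s) with hΦ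
  have hΦm : Measurable Φ := hmeas.min (hG.antitone.measurable.const_mul c)
  have hlim : Tendsto (fun s => Φ s / G s) atTop (𝓝 c) := by
    refine tendsto_const_nhds.congr' ?_
    filter_upwards [hc] with s hs
    rw [hΦ, eq_div_iff (hG.pos s).ne']
    simp only [min_eq_right hs]
  have hbd : ∀ s, |Φ s| ≤ max C |c| * G s := by
    intro s
    have hGs := hG.pos s
    have h1 : C * G s ≤ max C |c| * G s := by gcongr; exact le_max_left _ _
    have h2 : |c| * G s ≤ max C |c| * G s := by gcongr; exact le_max_right _ _
    have h3 : -(|c| * G s) ≤ c * G s := by rw [← neg_mul]; gcongr; exact neg_abs_le c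
    have h0 : 0 ≤ |c| * G s := by positivity
    rw [abs_le]
    refine ⟨le_min ?_ ?_, (min_le_left _ _).trans ((hC' s).trans h1)⟩
    · have : 0 ≤ ν.real (Set.Ioi s) := measureReal_nonneg
      linarith
    · linarith
  have := tendsto_integral_div_regTail hG hα hαβ hU hU0 hUβ hΦm hbd hlim
  filter_upwards [this.eventually (lt_mem_nhds (sub_lt_self _ hη)),
    eventually_gt_atTop 0] with t ht ht0
  have h4 := (lt_div_iff₀ (hG.pos t)).1 ht
  rw [measureReal_lt_mul ν hU hU0 ht0]
  refine le_trans h4.le (integral_mono ?_ ?_ ?_)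
  · exact integrable_regTail_div hG hα hαβ hU hU0 hUβ hΦm hbd ht0
  · refine Integrable.of_bound (C := 1) (Measurable.ite (measurableSet_lt measurable_const hU)
        (hmeas.comp (measurable_const.div hU)) measurable_const).aestronglyMeasurable
        (ae_of_all _ fun ω => ?_)
    split_ifs
    · rw [Real.norm_of_nonneg measureReal_nonneg]; exact measureReal_le_one
    · simp
  · intro ω
    dsimp only; split_ifs
    · exact min_le_left _ _
    · exact le_rfl

/-- `U |X|` and `|V|` are rarely large together: since `X` is independent of `(U, V)`, the
probability is of smaller order than `G`, whatever the dependence between `U` and `V`. -/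
lemma tendsto_joint_tail (hG : IsRegTail G α) (hα : 0 < α) (hαβ : α < β)
    (hU : Measurable U) (hU0 : ∀ ω, 0 ≤ U ω) (hUβ : Integrable (fun ω => U ω ^ β) P)
    (hV : Measurable V) {C δ : ℝ} (hδ : 0 < δ) (hC : ∀ s, ν.real {x | s < |x|} ≤ C * G s) :
    Tendsto (fun t => (P.prod ν).real {z | δ * t < U z.1 * |z.2| ∧ δ * t < |V z.1|} / G t)
      atTop (𝓝 0) := by
  obtain ⟨K, hK, hpot⟩ := hG.potter hαβ (by linarith)
  have hms : ∀ t, MeasurableSet {z : Ω × ℝ | δ * t < U z.1 * |z.2| ∧ δ * t < |V z.1|} := fun t =>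
    (measurableSet_lt_mul_abs hU _).inter
      (measurableSet_lt measurable_const (hV.comp measurable_fst).abs)
  have hC0 : 0 ≤ C := by
    have : 0 ≤ C * G 0 := measureReal_nonneg.trans (hC 0)
    exact nonneg_of_mul_nonneg_left this (hG.pos 0)
  simp_rw [fun t => measureReal_prod_eq_integral (P := P) ν (hms t), ← integral_div]
  rw [← integral_zero Ω ℝ (μ := P)]
  refine tendsto_integral_filter_of_dominated_convergence
    (fun ω => C * (K * (1 + (U ω / δ) ^ β))) ?_ ?_ ?_ ?_
  · exact Eventually.of_forall fun t =>
      ((measurable_measure_prodMk_left (hms t)).ennreal_toReal.div_const _).aestronglyMeasurable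
  · filter_upwards [eventually_gt_atTop 0] with t ht
    refine ae_of_all _ fun ω => ?_
    have hGt := hG.pos t
    have hβ0 : 0 ≤ (U ω / δ) ^ β := Real.rpow_nonneg (div_nonneg (hU0 ω) hδ.le) _
    rw [norm_div, Real.norm_of_nonneg hGt.le, div_le_iff₀ hGt,
      Real.norm_of_nonneg measureReal_nonneg]
    by_cases h : 0 < U ω
    · calc ν.real (Prod.mk ω ⁻¹' {z | δ * t < U z.1 * |z.2| ∧ δ * t < |V z.1|})
          ≤ ν.real {x | t / (U ω / δ) < |x|} := by
            refine measureReal_mono fun x hx => ?_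
            have hx1 : δ * t < U ω * |x| := hx.1
            show t / (U ω / δ) < |x|
            rw [div_div_eq_mul_div, div_lt_iff₀ h]
            linarith
        _ ≤ C * G (t / (U ω / δ)) := hC _
        _ ≤ C * (K * (1 + (U ω / δ) ^ β) * G t) := by
            gcongr; exact hpot t ht _ (by positivity)
        _ = _ := by ring
    · have h0 : U ω = 0 := le_antisymm (not_lt.1 h) (hU0 ω)
      have : Prod.mk ω ⁻¹' {z : Ω × ℝ | δ * t < U z.1 * |z.2| ∧ δ * t < |V z.1|} = ∅ := by
        ext x
        simp only [Set.mem_preimage, Set.mem_ofPred_eq, h0, zero_mul, Set.mem_empty_iff_false,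
          iff_false, not_and]
        intro h2
        have : 0 < δ * t := by positivity
        linarith
      rw [this, measureReal_empty]
      positivity
  · refine (((integrable_const 1).add ?_).const_mul K).const_mul C
    refine (hUβ.div_const (δ ^ β)).congr (ae_of_all _ fun ω => ?_)
    exact (Real.div_rpow (hU0 ω) hδ.le _).symm
  · refine ae_of_all _ fun ω => ?_
    refine tendsto_const_nhds.congr' ?_
    filter_upwards [eventually_ge_atTop (|V ω| / δ)] with t ht
    have : Prod.mk ω ⁻¹' {z : Ω × ℝ | δ * t < U z.1 * |z.2| ∧ δ * t < |V z.1|} = ∅ := by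
      ext x
      simp only [Set.mem_preimage, Set.mem_ofPred_eq, Set.mem_empty_iff_false, iff_false, not_and,
        not_lt]
      intro _
      rwa [div_le_iff₀ hδ, mul_comm] at ht
    simp [this]

/-- Eventual upper bounds for the tails of `X` and `V` yield one for the tail of `U X + V`. -/
lemma eventually_step_le (hG : IsRegTail G α) (hα : 0 < α) (hαβ : α < β)
    (hU : Measurable U) (hU0 : ∀ ω, 0 ≤ U ω) (hUβ : Integrable (fun ω => U ω ^ β) P)
    (hV : Measurable V) {C c p η : ℝ} (hη : 0 < η) (hC : ∀ s, ν.real {x | s < |x|} ≤ C * G s)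
    (hc : ∀ᶠ s in atTop, ν.real (Set.Ioi s) ≤ c * G s)
    (hp : ∀ᶠ s in atTop, P.real {ω | s < V ω} ≤ p * G s) :
    ∀ᶠ t in atTop, (P.prod ν).real {z | t < U z.1 * z.2 + V z.1} ≤
      (c * ∫ ω, U ω ^ α ∂P + p + η) * G t := by
  set m := ∫ ω, U ω ^ α ∂P
  -- the factor by which an error in `G` at the shifted argument is multiplied
  set M := |c * m + η / 3 + p| + 1
  have hM : 0 < M := by positivity
  obtain ⟨δ, hδ0, hδ1, hδ⟩ := hG.exists_shrink_le (η := η / 3 / M) (by positivity)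
  have hscale : Tendsto (fun t : ℝ => (1 - δ) * t) atTop atTop :=
    tendsto_id.const_mul_atTop (by linarith)
  have h1 := hscale.eventually
    (eventually_prod_tail_le hG hα hαβ hU hU0 hUβ (η := η / 3) (by positivity) hC hc)
  have h2 := hscale.eventually hp
  have h3 := (tendsto_joint_tail hG hα hαβ hU hU0 hUβ hV hδ0 hC).eventually
    (gt_mem_nhds (show (0 : ℝ) < η / 3 by positivity))
  filter_upwards [h1, h2, h3, hδ, eventually_gt_atTop 0] with t h1 h2 h3 h4 ht
  have hGt := hG.pos t
  rw [div_lt_iff₀ hGt] at h3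
  have hVm : (P.prod ν).real {z | (1 - δ) * t < V z.1} = P.real {ω | (1 - δ) * t < V ω} := by
    have : {z : Ω × ℝ | (1 - δ) * t < V z.1} = {ω | (1 - δ) * t < V ω} ×ˢ Set.univ := by
      ext; simp
    rw [this, measureReal_prod_prod, probReal_univ, mul_one]
  -- one of the two summands exceeds `(1 - δ) t`, or both exceed `δ t`
  have hsub : {z : Ω × ℝ | t < U z.1 * z.2 + V z.1} ⊆
      ({z | (1 - δ) * t < U z.1 * z.2} ∪ {z | (1 - δ) * t < V z.1}) ∪
        {z | δ * t < U z.1 * |z.2| ∧ δ * t < |V z.1|} := by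
    intro z hz
    simp only [Set.mem_ofPred_eq, Set.mem_union] at hz ⊢
    by_contra! hcon
    obtain ⟨⟨ha, hb⟩, hcc⟩ := hcon
    have e1 := mul_le_mul_of_nonneg_left (le_abs_self z.2) (hU0 z.1)
    have e2 := le_abs_self (V z.1)
    have := hcc (by linarith)
    linarith
  have h5 := (measureReal_mono hsub (μ := P.prod ν)).trans
    ((measureReal_union_le _ _).trans (add_le_add_left (measureReal_union_le _ _) _))
  rw [hVm] at h5
  have h6 : (c * m + η / 3 + p) * G ((1 - δ) * t) ≤
      (c * m + η / 3 + p) * G t + η / 3 * G t := by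
    have e0 : G t ≤ G ((1 - δ) * t) := hG.antitone (by nlinarith)
    have e1 : (c * m + η / 3 + p) * (G ((1 - δ) * t) - G t) ≤
        M * (G ((1 - δ) * t) - G t) := by
      refine mul_le_mul_of_nonneg_right ?_ (by linarith)
      have := le_abs_self (c * m + η / 3 + p)
      simp only [M]; linarith
    have e2 : M * (G ((1 - δ) * t) - G t) ≤ M * (η / 3 / M * G t) :=
      mul_le_mul_of_nonneg_left (by linarith) hM.le
    have e3 : M * (η / 3 / M * G t) = η / 3 * G t := by field_simp
    linarith
  linarith

/-- Eventual lower bounds for the tails of `X` and `V` yield one for the tail of `U X + V`; the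
bound on both tails of `X` serves to exclude cancellation. -/
lemma eventually_le_step (hG : IsRegTail G α) (hα : 0 < α) (hαβ : α < β)
    (hU : Measurable U) (hU0 : ∀ ω, 0 ≤ U ω) (hUβ : Integrable (fun ω => U ω ^ β) P)
    (hV : Measurable V) {C c p η : ℝ} (hη : 0 < η) (hC : ∀ s, ν.real {x | s < |x|} ≤ C * G s)
    (hc : ∀ᶠ s in atTop, c * G s ≤ ν.real (Set.Ioi s))
    (hp : ∀ᶠ s in atTop, p * G s ≤ P.real {ω | s < V ω}) :
    ∀ᶠ t in atTop, (c * ∫ ω, U ω ^ α ∂P + p - η) * G t ≤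
      (P.prod ν).real {z | t < U z.1 * z.2 + V z.1} := by
  set m := ∫ ω, U ω ^ α ∂P
  -- the factor by which an error in `G` at the shifted argument is multiplied
  set M := |c * m - η / 4 + p| + 1
  have hM : 0 < M := by positivity
  obtain ⟨δ, hδ0, hδ⟩ := hG.exists_le_stretch (η := η / 4 / M) (by positivity)
  have hscale : Tendsto (fun t : ℝ => (1 + δ) * t) atTop atTop :=
    tendsto_id.const_mul_atTop (by linarith)
  have h1 := hscale.eventually
    (eventually_le_prod_tail hG hα hαβ hU hU0 hUβ (η := η / 4) (by positivity) hC hc)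
  have h2 := hscale.eventually hp
  have h3 := (tendsto_joint_tail hG hα hαβ hU hU0 hUβ hV hδ0 hC).eventually
    (gt_mem_nhds (show (0 : ℝ) < η / 4 by positivity))
  filter_upwards [h1, h2, h3, hδ, eventually_gt_atTop 0] with t h1 h2 h3 h4 ht
  have hGt := hG.pos t
  rw [div_lt_iff₀ hGt] at h3
  have hδt : 0 < δ * t := by positivity
  have hVm : (P.prod ν).real {z | (1 + δ) * t < V z.1} = P.real {ω | (1 + δ) * t < V ω} := by
    have : {z : Ω × ℝ | (1 + δ) * t < V z.1} = {ω | (1 + δ) * t < V ω} ×ˢ Set.univ := by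
      ext; simp
    rw [this, measureReal_prod_prod, probReal_univ, mul_one]
  set J := {z : Ω × ℝ | δ * t < U z.1 * |z.2| ∧ δ * t < |V z.1|}
  set S := {z : Ω × ℝ | t < U z.1 * z.2 + V z.1}
  set E := {z : Ω × ℝ | (1 + δ) * t < U z.1 * z.2 ∧ |V z.1| ≤ δ * t}
  set F := {z : Ω × ℝ | (1 + δ) * t < V z.1 ∧ U z.1 * |z.2| ≤ δ * t}
  have hFm : MeasurableSet F :=
    (measurableSet_lt measurable_const (hV.comp measurable_fst)).inter
      (measurableSet_le ((hU.comp measurable_fst).mul measurable_snd.abs) measurable_const)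
  -- in each of the disjoint events `E` and `F` one summand is large and the other is not
  have hdisj : Disjoint E F := by
    rw [Set.disjoint_left]
    rintro z ⟨_, hz⟩ ⟨hz', _⟩
    have := le_abs_self (V z.1)
    linarith
  have hEF : (P.prod ν).real E + (P.prod ν).real F ≤ (P.prod ν).real S := by
    rw [← measureReal_union hdisj hFm]
    refine measureReal_mono (Set.union_subset ?_ ?_)
    · rintro z ⟨ha, hb⟩
      have := neg_abs_le (V z.1)
      show t < _
      linarith
    · rintro z ⟨ha, hb⟩
      have := mul_le_mul_of_nonneg_left (neg_abs_le z.2) (hU0 z.1)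
      show t < _
      linarith
  have hE : (P.prod ν).real {z | (1 + δ) * t < U z.1 * z.2} ≤
      (P.prod ν).real E + (P.prod ν).real J := by
    refine (measureReal_mono ?_).trans (measureReal_union_le _ _)
    intro z (hz : (1 + δ) * t < U z.1 * z.2)
    by_cases h : |V z.1| ≤ δ * t
    · exact Or.inl ⟨hz, h⟩
    · refine Or.inr ⟨?_, not_le.1 h⟩
      have := mul_le_mul_of_nonneg_left (le_abs_self z.2) (hU0 z.1)
      linarith
  have hF : (P.prod ν).real {z | (1 + δ) * t < V z.1} ≤
      (P.prod ν).real F + (P.prod ν).real J := by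
    refine (measureReal_mono ?_).trans (measureReal_union_le _ _)
    intro z (hz : (1 + δ) * t < V z.1)
    by_cases h : U z.1 * |z.2| ≤ δ * t
    · exact Or.inl ⟨hz, h⟩
    · refine Or.inr ⟨not_le.1 h, ?_⟩
      have := le_abs_self (V z.1)
      linarith
  rw [hVm] at hF
  have h6 : (c * m - η / 4 + p) * G t - η / 4 * G t ≤
      (c * m - η / 4 + p) * G ((1 + δ) * t) := by
    have e0 : G ((1 + δ) * t) ≤ G t := hG.antitone (by nlinarith)
    have e1 : (c * m - η / 4 + p) * (G t - G ((1 + δ) * t)) ≤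
        M * (G t - G ((1 + δ) * t)) := by
      refine mul_le_mul_of_nonneg_right ?_ (by linarith)
      have := le_abs_self (c * m - η / 4 + p)
      simp only [M]; linarith
    have e2 : M * (G t - G ((1 + δ) * t)) ≤ M * (η / 4 / M * G t) :=
      mul_le_mul_of_nonneg_left (by linarith) hM.le
    have e3 : M * (η / 4 / M * G t) = η / 4 * G t := by field_simp
    linarith
  linarith

/-- The principle of one big jump for `U X + V`, where `X ∼ ν` is independent of `(U, V)`:
the tail constants of `U X` and of `V` add up. -/
lemma tendsto_step (hG : IsRegTail G α) (hα : 0 < α) (hαβ : α < β)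
    (hU : Measurable U) (hU0 : ∀ ω, 0 ≤ U ω) (hUβ : Integrable (fun ω => U ω ^ β) P)
    (hV : Measurable V) {C c p : ℝ} (hC : ∀ s, ν.real {x | s < |x|} ≤ C * G s)
    (hc : Tendsto (fun s => ν.real (Set.Ioi s) / G s) atTop (𝓝 c))
    (hp : Tendsto (fun s => P.real {ω | s < V ω} / G s) atTop (𝓝 p)) :
    Tendsto (fun t => (P.prod ν).real {z | t < U z.1 * z.2 + V z.1} / G t) atTop
      (𝓝 (c * ∫ ω, U ω ^ α ∂P + p)) := by
  set m := ∫ ω, U ω ^ α ∂P with hm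
  have hm0 : 0 ≤ m := integral_nonneg fun ω => Real.rpow_nonneg (hU0 ω) _
  rw [tendsto_order]
  constructor
  · intro a ha
    set η := (c * m + p - a) / (m + 3)
    have hη : 0 < η := div_pos (by linarith) (by linarith)
    have hηe : η * (m + 3) = c * m + p - a := div_mul_cancel₀ _ (by linarith)
    have h1 : ∀ᶠ s in atTop, (c - η) * G s ≤ ν.real (Set.Ioi s) := by
      filter_upwards [hc.eventually (lt_mem_nhds (sub_lt_self c hη))] with s hs
      exact ((lt_div_iff₀ (hG.pos s)).1 hs).le
    have h2 : ∀ᶠ s in atTop, (p - η) * G s ≤ P.real {ω | s < V ω} := by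
      filter_upwards [hp.eventually (lt_mem_nhds (sub_lt_self p hη))] with s hs
      exact ((lt_div_iff₀ (hG.pos s)).1 hs).le
    filter_upwards [eventually_le_step hG hα hαβ hU hU0 hUβ hV hη hC h1 h2] with t ht
    rw [lt_div_iff₀ (hG.pos t)]
    refine lt_of_lt_of_le ?_ ht
    have := hG.pos t
    gcongr
    nlinarith
  · intro a ha
    set η := (a - (c * m + p)) / (m + 3)
    have hη : 0 < η := div_pos (by linarith) (by linarith)
    have hηe : η * (m + 3) = a - (c * m + p) := div_mul_cancel₀ _ (by linarith)
    have h1 : ∀ᶠ s in atTop, ν.real (Set.Ioi s) ≤ (c + η) * G s := by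
      filter_upwards [hc.eventually (gt_mem_nhds (lt_add_of_pos_right c hη))] with s hs
      exact ((div_lt_iff₀ (hG.pos s)).1 hs).le
    have h2 : ∀ᶠ s in atTop, P.real {ω | s < V ω} ≤ (p + η) * G s := by
      filter_upwards [hp.eventually (gt_mem_nhds (lt_add_of_pos_right p hη))] with s hs
      exact ((div_lt_iff₀ (hG.pos s)).1 hs).le
    filter_upwards [eventually_step_le hG hα hαβ hU hU0 hUβ hV hη hC h1 h2] with t ht
    rw [div_lt_iff₀ (hG.pos t)]
    refine lt_of_le_of_lt ht ?_
    have := hG.pos t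
    gcongr
    nlinarith

end OneStep

/-! ### Tails of solutions of `S = U S + V` -/

lemma cond_measureReal_apply {X : Type*} [MeasurableSpace X] (κ : Measure X) {s : Set X}
    (hs : MeasurableSet s) (t : Set X) :
    (ProbabilityTheory.cond κ s).real t = (κ.real s)⁻¹ * κ.real (s ∩ t) := by
  rw [measureReal_def, ProbabilityTheory.cond_apply hs, ENNReal.toReal_mul, ENNReal.toReal_inv]
  rfl

section FixedPoint

variable {Ω : Type*} [MeasurableSpace Ω] {P : Measure Ω} [IsProbabilityMeasure P]
  {ν : Measure ℝ} [IsProbabilityMeasure ν] {U V : Ω → ℝ} {G : ℝ → ℝ} {α β : ℝ}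

/-- A bound that improves by a factor `r < 1` whenever it is inserted into itself is trivial. -/
lemma nonpos_of_self_improving {ι : Sort*} {f : ι → ℝ} {r : ℝ} (hr0 : 0 ≤ r) (hr : r < 1)
    (h1 : ∀ i, f i ≤ 1) (h : ∀ ρ, 0 ≤ ρ → (∀ i, f i ≤ ρ) → ∀ i, f i ≤ r * ρ) (i : ι) :
    f i ≤ 0 := by
  have hn : ∀ n : ℕ, ∀ i, f i ≤ r ^ n := by
    intro n
    induction n with
    | zero => simpa using h1
    | succ n ih =>
      intro i
      rw [pow_succ']
      exact h _ (pow_nonneg hr0 n) ih i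
  exact ge_of_tendsto' (tendsto_pow_atTop_nhds_zero_of_lt_one hr0 hr) fun n => hn n i

/-- Stochastic comparison: a subsolution of `|S| ≤ U |S| + V` (in the sense of tails) is
stochastically dominated by a supersolution. If the tails of the former exceed those of the latter
by at most `ρ`, then, as the two sides agree where `U = 0`, they do so by at most `P(U > 0) ρ`. -/
lemma tail_le_of_subsolution_of_supersolution (hU : Measurable U) (hU0 : ∀ ω, 0 ≤ U ω)
    (hV : Measurable V) (hr : P.real {ω | 0 < U ω} < 1)
    {κ : Measure ℝ} [IsProbabilityMeasure κ]
    (hν : ∀ t, ν.real (Set.Ioi t) ≤ (P.prod ν).real {z | t < U z.1 * z.2 + V z.1})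
    (hκ : ∀ t, (P.prod κ).real {z | t < U z.1 * z.2 + V z.1} ≤ κ.real (Set.Ioi t)) (t : ℝ) :
    ν.real (Set.Ioi t) ≤ κ.real (Set.Ioi t) := by
  refine sub_nonpos.1 (nonpos_of_self_improving (f := fun t => ν.real (Set.Ioi t) -
    κ.real (Set.Ioi t)) measureReal_nonneg hr ?_ ?_ t)
  · intro t
    have h1 : ν.real (Set.Ioi t) ≤ 1 := measureReal_le_one
    have h2 : 0 ≤ κ.real (Set.Ioi t) := measureReal_nonneg
    linarith
  · intro ρ hρ hle t
    have hm := measurableSet_lt_mul_add hU hV t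
    have hset : MeasurableSet {ω | 0 < U ω} := measurableSet_lt measurable_const hU
    calc ν.real (Set.Ioi t) - κ.real (Set.Ioi t)
        ≤ (P.prod ν).real {z | t < U z.1 * z.2 + V z.1} -
            (P.prod κ).real {z | t < U z.1 * z.2 + V z.1} := sub_le_sub (hν t) (hκ t)
      _ = ∫ ω, (ν.real (Prod.mk ω ⁻¹' {z : Ω × ℝ | t < U z.1 * z.2 + V z.1}) -
            κ.real (Prod.mk ω ⁻¹' {z : Ω × ℝ | t < U z.1 * z.2 + V z.1})) ∂P := by
          rw [measureReal_prod_eq_integral ν hm, measureReal_prod_eq_integral κ hm, integral_sub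
            (integrable_measureReal_section ν hm) (integrable_measureReal_section κ hm)]
      _ ≤ ∫ ω, {ω | 0 < U ω}.indicator (fun _ => ρ) ω ∂P := by
          refine integral_mono ((integrable_measureReal_section ν hm).sub
            (integrable_measureReal_section κ hm)) ((integrable_const ρ).indicator hset) ?_
          intro ω
          by_cases h : 0 < U ω
          · have : Prod.mk ω ⁻¹' {z : Ω × ℝ | t < U z.1 * z.2 + V z.1} =
                Set.Ioi ((t - V ω) / U ω) := by
              ext x
              simp [div_lt_iff₀ h, mul_comm, sub_lt_iff_lt_add]
            simpa [this, Set.indicator, h] using hle ((t - V ω) / U ω)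
          · have h0 : U ω = 0 := le_antisymm (not_lt.1 h) (hU0 ω)
            by_cases hv : t < V ω
            · have : Prod.mk ω ⁻¹' {z : Ω × ℝ | t < U z.1 * z.2 + V z.1} = Set.univ := by
                ext x; simp [h0, hv]
              simp [this, Set.indicator, h]
            · have : Prod.mk ω ⁻¹' {z : Ω × ℝ | t < U z.1 * z.2 + V z.1} = ∅ := by
                ext x; simp [h0, hv]
              simp [this, Set.indicator, h]
      _ = P.real {ω | 0 < U ω} * ρ := by
          rw [integral_indicator_const _ hset, smul_eq_mul]

/-- Conditioning a law on exceeding a level `t₀`, beyond which it is a supersolution, yields a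
law that is a supersolution everywhere. -/
lemma cond_supersolution (hU : Measurable U) (hV : Measurable V) {κ : Measure ℝ}
    [IsProbabilityMeasure κ] {t₀ : ℝ} (h0 : 0 < κ.real (Set.Ioi t₀))
    (h : ∀ t, t₀ ≤ t → (P.prod κ).real {z | t < U z.1 * z.2 + V z.1} ≤ κ.real (Set.Ioi t))
    (t : ℝ) :
    (P.prod (ProbabilityTheory.cond κ (Set.Ioi t₀))).real {z | t < U z.1 * z.2 + V z.1} ≤
      (ProbabilityTheory.cond κ (Set.Ioi t₀)).real (Set.Ioi t) := by
  have hne : κ (Set.Ioi t₀) ≠ 0 := fun h' => by simp [measureReal_def, h'] at h0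
  have := cond_isProbabilityMeasure hne
  rcases le_or_gt t t₀ with ht | ht
  · have h1 : (ProbabilityTheory.cond κ (Set.Ioi t₀)).real (Set.Ioi t) = 1 := by
      rw [cond_measureReal_apply _ measurableSet_Ioi, Set.inter_eq_left.2 (Set.Ioi_subset_Ioi ht),
        inv_mul_cancel₀ h0.ne']
    rw [h1]
    exact measureReal_le_one
  · have hm := measurableSet_lt_mul_add hU hV t
    rw [cond_measureReal_apply _ measurableSet_Ioi, Set.inter_eq_right.2 (Set.Ioi_subset_Ioi ht.le)]
    refine le_trans ?_ (mul_le_mul_of_nonneg_left (h t ht.le) (inv_nonneg.2 h0.le))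
    rw [measureReal_prod_eq_integral _ hm, measureReal_prod_eq_integral _ hm,
      ← integral_const_mul]
    refine integral_mono (integrable_measureReal_section _ hm)
      ((integrable_measureReal_section _ hm).const_mul _) fun ω => ?_
    dsimp only
    rw [cond_measureReal_apply _ measurableSet_Ioi]
    gcongr
    · exact measure_ne_top _ _
    · exact Set.inter_subset_right

/-- The a priori bound: the tails of a solution are at most of the order of `P(|V| > t)`. For a
large multiple `l |V|`, conditioned on being large, is a supersolution. -/
lemma exists_tail_le_of_fixedPoint (hG : IsRegTail G α) (hα : 0 < α) (hαβ : α < β)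
    (hU : Measurable U) (hU0 : ∀ ω, 0 ≤ U ω) (hUβ : Integrable (fun ω => U ω ^ β) P)
    (hV : Measurable V) (hGV : ∀ t, P.real {ω | t < |V ω|} = G t)
    (hr : P.real {ω | 0 < U ω} < 1) (hm : ∫ ω, U ω ^ α ∂P < 1)
    (hν : ∀ t, ν.real {x | t < |x|} ≤ (P.prod ν).real {z | t < U z.1 * |z.2| + |V z.1|}) :
    ∃ C, ∀ t, ν.real {x | t < |x|} ≤ C * G t := by
  set m := ∫ ω, U ω ^ α ∂P with hmdef
  -- any constant `c` with `m c + 1 < c` will do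
  set c := 2 / (1 - m)
  have hm0 : 0 ≤ m := integral_nonneg fun ω => Real.rpow_nonneg (hU0 ω) _
  have hc : 0 < c := div_pos two_pos (by linarith)
  have hcm : c * (1 - m) = 2 := div_mul_cancel₀ _ (by linarith)
  set l := c ^ α⁻¹
  have hl : 0 < l := Real.rpow_pos_of_pos hc _
  have hlα : l ^ α = c := Real.rpow_inv_rpow hc.le hα.ne'
  have hVl : Measurable fun ω => l * |V ω| := hV.abs.const_mul l
  set κ := P.map fun ω => l * |V ω| with hκdef
  have : IsProbabilityMeasure κ := Measure.isProbabilityMeasure_map hVl.aemeasurable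
  have hκt : ∀ t, κ.real (Set.Ioi t) = G (t / l) := by
    intro t
    rw [hκdef, map_measureReal_apply hVl measurableSet_Ioi, ← hGV]
    congr 1
    ext ω
    simp [div_lt_iff₀ hl, mul_comm]
  have hκabs : ∀ t, κ.real {x | t < |x|} = κ.real (Set.Ioi t) := by
    intro t
    rw [hκdef, map_measureReal_apply hVl measurableSet_Ioi,
      map_measureReal_apply hVl (measurableSet_lt measurable_const continuous_abs.measurable)]
    congr 1
    ext ω
    simp [abs_mul, abs_of_pos hl]
  obtain ⟨K, hK, hpot⟩ := hG.potter hαβ (by linarith)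
  have hlim : Tendsto (fun t => κ.real (Set.Ioi t) / G t) atTop (𝓝 c) := by
    simp_rw [hκt]
    exact hlα ▸ hG.tendsto_div hl
  have hGneg : ∀ t, t < 0 → G t = 1 := by
    intro t ht
    rw [← hGV]
    have : {ω | t < |V ω|} = Set.univ := by
      ext ω; simpa using ht.trans_le (abs_nonneg _)
    rw [this, probReal_univ]
  have hG1 : ∀ t, G t ≤ 1 := fun t => hGV t ▸ measureReal_le_one
  have hκC : ∀ s, κ.real {x | s < |x|} ≤
      max (K * (1 + l ^ β)) 1 * G s := by
    intro s
    rw [hκabs, hκt]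
    have hGs := hG.pos s
    rcases lt_trichotomy s 0 with h | h | h
    · refine (hG1 _).trans ?_
      rw [hGneg s h, mul_one]
      exact le_max_right _ _
    · subst h
      rw [zero_div]
      refine le_mul_of_one_le_left hGs.le ?_
      exact le_max_right _ _
    · refine (hpot s h l hl).trans ?_
      gcongr
      exact le_max_left _ _
  have hsup := tendsto_step (P := P) hG hα hαβ hU hU0 hUβ hV.abs hκC hlim (p := 1)
    (tendsto_const_nhds.congr fun s => by rw [hGV, div_self (hG.pos s).ne'])
  have hlt : c * m + 1 < c := by linarith
  have hev : ∀ᶠ t in atTop, (P.prod κ).real {z | t < U z.1 * z.2 + |V z.1|} ≤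
      κ.real (Set.Ioi t) := by
    obtain ⟨d, hd1, hd2⟩ := exists_between hlt
    filter_upwards [hsup.eventually (gt_mem_nhds hd1), hlim.eventually (lt_mem_nhds hd2)]
      with t h1 h2
    have hGt := hG.pos t
    rw [div_lt_iff₀ hGt] at h1
    rw [lt_div_iff₀ hGt] at h2
    exact (h1.trans h2).le
  obtain ⟨t₀, ht₀⟩ := eventually_atTop.1 hev
  have hκ0 : 0 < κ.real (Set.Ioi t₀) := hκt t₀ ▸ hG.pos _
  have hne : κ (Set.Ioi t₀) ≠ 0 := fun h' => by simp [measureReal_def, h'] at hκ0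
  have := cond_isProbabilityMeasure hne
  -- compare the law of `|S|` with the conditioned law
  have hνabs : IsProbabilityMeasure (ν.map fun x => |x|) :=
    Measure.isProbabilityMeasure_map continuous_abs.measurable.aemeasurable
  have hνt : ∀ t, (ν.map fun x => |x|).real (Set.Ioi t) = ν.real {x | t < |x|} := fun t =>
    map_measureReal_apply continuous_abs.measurable measurableSet_Ioi
  have hcomp := tail_le_of_subsolution_of_supersolution (P := P) (ν := ν.map fun x => |x|) hU hU0
    hV.abs hr (κ := ProbabilityTheory.cond κ (Set.Ioi t₀)) (fun t => ?_)
    (cond_supersolution hU hV.abs hκ0 ht₀)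
  · refine ⟨(κ.real (Set.Ioi t₀))⁻¹ * max (K * (1 + l ^ β)) 1, fun t => ?_⟩
    have h1 := hcomp t
    rw [hνt, cond_measureReal_apply _ measurableSet_Ioi] at h1
    refine h1.trans ?_
    rw [mul_assoc]
    refine mul_le_mul_of_nonneg_left ?_ (inv_nonneg.2 hκ0.le)
    exact (measureReal_mono Set.inter_subset_right).trans (hκabs t ▸ hκC t)
  · rw [hνt]
    refine (hν t).trans (le_of_eq ?_)
    rw [measureReal_prod_eq_integral _ (measurableSet_lt_mul_add hU hV.abs t),
      measureReal_prod_eq_integral]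
    · refine integral_congr_ae (ae_of_all _ fun ω => ?_)
      dsimp only
      rw [map_measureReal_apply continuous_abs.measurable]
      · rfl
      · exact measurable_prodMk_left (measurableSet_lt_mul_add hU hV.abs t)
    · exact measurableSet_lt measurable_const
        (((hU.comp measurable_fst).mul measurable_snd.abs).add (hV.comp measurable_fst).abs)

/-- Once the tail of a solution of `S = U S + V` is known to be at most of the order of `G`, its
tail constant `c` is forced to satisfy `c = m c + p`, where `m = E[U ^ α]`: upper and lower bounds
for `c` contract towards `p / (1 - m)` under iteration of the one-step asymptotics. -/
lemma tendsto_tail_of_fixedPoint (hG : IsRegTail G α) (hα : 0 < α) (hαβ : α < β)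
    (hU : Measurable U) (hU0 : ∀ ω, 0 ≤ U ω) (hUβ : Integrable (fun ω => U ω ^ β) P)
    (hV : Measurable V) (hm : ∫ ω, U ω ^ α ∂P < 1) {C p : ℝ}
    (hC : ∀ t, ν.real {x | t < |x|} ≤ C * G t)
    (hp : Tendsto (fun s => P.real {ω | s < V ω} / G s) atTop (𝓝 p))
    (hν : ∀ t, ν.real (Set.Ioi t) = (P.prod ν).real {z | t < U z.1 * z.2 + V z.1}) :
    Tendsto (fun t => ν.real (Set.Ioi t) / G t) atTop (𝓝 (p / (1 - ∫ ω, U ω ^ α ∂P))) := by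
  set m := ∫ ω, U ω ^ α ∂P with hmdef
  have hm0 : 0 ≤ m := integral_nonneg fun ω => Real.rpow_nonneg (hU0 ω) _
  have h1m : 0 < 1 - m := by linarith
  have hmn := tendsto_pow_atTop_nhds_zero_of_lt_one hm0 hm
  rw [tendsto_order]
  constructor
  -- the lower bounds start from the trivial constant `0`
  · intro a ha
    set η := (p / (1 - m) - a) * (1 - m) / 4
    have hη : 0 < η := by
      have : 0 < p / (1 - m) - a := by linarith
      positivity
    set c := (p - 2 * η) / (1 - m)
    have hc : c * (1 - m) = p - 2 * η := div_mul_cancel₀ _ h1m.ne'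
    have hac : a < c := by
      have h2 : η * 4 = p - a * (1 - m) := by
        simp only [η]; field_simp
      rw [lt_div_iff₀ h1m]
      linarith
    have hpe : ∀ᶠ s in atTop, (p - η) * G s ≤ P.real {ω | s < V ω} := by
      filter_upwards [hp.eventually (lt_mem_nhds (sub_lt_self p hη))] with s hs
      exact ((lt_div_iff₀ (hG.pos s)).1 hs).le
    have hiter : ∀ n : ℕ, ∀ᶠ s in atTop, (c - m ^ n * c) * G s ≤ ν.real (Set.Ioi s) := by
      intro n
      induction n with
      | zero => exact Eventually.of_forall fun s => by simp
      | succ n ih =>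
        filter_upwards [eventually_le_step hG hα hαβ hU hU0 hUβ hV hη hC ih hpe] with s hs
        rw [hν]
        refine le_trans (le_of_eq ?_) hs
        rw [← hmdef, pow_succ]
        congr 1
        linarith
    have hlim : Tendsto (fun n : ℕ => c - m ^ n * c) atTop (𝓝 c) := by
      simpa using tendsto_const_nhds.sub (hmn.mul_const c)
    obtain ⟨n, hn⟩ := (hlim.eventually (lt_mem_nhds hac)).exists
    filter_upwards [hiter n] with t ht
    rw [lt_div_iff₀ (hG.pos t)]
    exact lt_of_lt_of_le (mul_lt_mul_of_pos_right hn (hG.pos t)) ht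
  -- the upper bounds start from the a priori constant `C`
  · intro a ha
    set η := (a - p / (1 - m)) * (1 - m) / 4
    have hη : 0 < η := by
      have : 0 < a - p / (1 - m) := by linarith
      positivity
    set c := (p + 2 * η) / (1 - m)
    have hc : c * (1 - m) = p + 2 * η := div_mul_cancel₀ _ h1m.ne'
    have hac : c < a := by
      have h2 : η * 4 = a * (1 - m) - p := by
        simp only [η]; field_simp
      rw [div_lt_iff₀ h1m]
      linarith
    have hpe : ∀ᶠ s in atTop, P.real {ω | s < V ω} ≤ (p + η) * G s := by
      filter_upwards [hp.eventually (gt_mem_nhds (lt_add_of_pos_right p hη))] with s hs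
      exact ((div_lt_iff₀ (hG.pos s)).1 hs).le
    have hiter : ∀ n : ℕ, ∀ᶠ s in atTop, ν.real (Set.Ioi s) ≤ (c + m ^ n * (C - c)) * G s := by
      intro n
      induction n with
      | zero =>
        refine Eventually.of_forall fun s => ?_
        rw [pow_zero, one_mul, add_sub_cancel]
        exact (measureReal_Ioi_le_abs ν s).trans (hC s)
      | succ n ih =>
        filter_upwards [eventually_step_le hG hα hαβ hU hU0 hUβ hV hη hC ih hpe] with s hs
        rw [hν]
        refine hs.trans (le_of_eq ?_)
        rw [← hmdef, pow_succ]
        congr 1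
        linarith
    have hlim : Tendsto (fun n : ℕ => c + m ^ n * (C - c)) atTop (𝓝 c) := by
      simpa using tendsto_const_nhds.add (hmn.mul_const (C - c))
    obtain ⟨n, hn⟩ := (hlim.eventually (gt_mem_nhds hac)).exists
    filter_upwards [hiter n] with t ht
    rw [div_lt_iff₀ (hG.pos t)]
    exact lt_of_le_of_lt ht (mul_lt_mul_of_pos_right hn (hG.pos t))

end FixedPoint

/-! ### The perpetuity, the stopped sum and their laws -/

section Perpetuity

/-- The first index at which the multiplier `a` of a sequence of pairs `(a, b)` is nonpositive
(with the irrelevant value `0` where there is none). -/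
noncomputable def firstNonpos (x : ℕ → ℝ × ℝ) : ℕ := sInf {k | (x k).1 ≤ 0}

/-- The perpetuity `b₀ + a₀⁺ b₁ + a₀⁺ a₁⁺ b₂ + ⋯`. The products of the `a⁺` vanish after the first
nonpositive `a`, so that the sum is written as a finite one, in which no positive parts are
needed. -/
noncomputable def perpetuity (x : ℕ → ℝ × ℝ) : ℝ :=
  ∑ k ∈ Finset.range (firstNonpos x + 1), (∏ j ∈ Finset.range k, (x j).1) * (x k).2

lemma perpetuity_eq {x : ℕ → ℝ × ℝ} (h : ∃ k, (x k).1 ≤ 0) :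
    perpetuity x = max (x 0).1 0 * perpetuity (fun n => x (n + 1)) + (x 0).2 := by
  rcases le_or_gt (x 0).1 0 with h0 | h0
  · have : firstNonpos x = 0 := Nat.sInf_eq_zero.2 (Or.inl h0)
    simp [perpetuity, this, max_eq_right h0]
  · have hx : firstNonpos x = firstNonpos (fun n => x (n + 1)) + 1 := by
      obtain ⟨k, hk⟩ := h
      obtain ⟨k, rfl⟩ : ∃ j, k = j + 1 :=
        Nat.exists_eq_succ_of_ne_zero fun hk0 => by subst hk0; linarith
      refine IsLeast.csInf_eq ⟨Nat.sInf_mem (s := {k | (x (k + 1)).1 ≤ 0}) ⟨k, hk⟩, ?_⟩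
      intro n hn
      cases n with
      | zero => exact absurd h0 (not_lt.2 hn)
      | succ n => exact Nat.succ_le_succ (Nat.sInf_le hn)
    rw [perpetuity, perpetuity, hx, Finset.sum_range_succ', Finset.mul_sum, max_eq_left h0.le]
    simp [Finset.prod_range_succ', mul_comm, mul_left_comm]

lemma measurable_sInf_nat {X : Type*} [MeasurableSpace X] {s : ℕ → Set X}
    (hs : ∀ n, MeasurableSet (s n)) : Measurable fun x => sInf {n | x ∈ s n} := by
  refine measurable_of_Iic fun m => ?_
  have : (fun x => sInf {n | x ∈ s n}) ⁻¹' Set.Iic m =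
      (⋃ n ∈ Set.Iic m, s n) ∪ ⋂ n, (s n)ᶜ := by
    ext x
    simp only [Set.mem_preimage, Set.mem_Iic, Set.mem_union, Set.mem_iUnion, Set.mem_iInter,
      Set.mem_compl_iff, exists_prop]
    rcases Set.eq_empty_or_nonempty {n | x ∈ s n} with he | he
    · rw [he, Nat.sInf_empty]
      refine ⟨fun _ => Or.inr fun n hn => ?_, fun _ => Nat.zero_le _⟩
      exact (Set.ext_iff.1 he n).1 hn
    · refine ⟨fun h => Or.inl ⟨_, h, Nat.sInf_mem he⟩, ?_⟩
      rintro (⟨n, hn, hx⟩ | h)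
      · exact (Nat.sInf_le hx).trans hn
      · obtain ⟨n, hn⟩ := he
        exact absurd hn (h n)
  rw [this]
  exact (MeasurableSet.biUnion (Set.to_countable _) fun n _ => hs n).union
    (MeasurableSet.iInter fun n => (hs n).compl)

lemma measurable_perpetuity : Measurable perpetuity := by
  have h1 : Measurable firstNonpos := measurable_sInf_nat
    (s := fun k => {x : ℕ → ℝ × ℝ | (x k).1 ≤ 0})
    fun k => measurableSet_le (measurable_pi_apply k).fst measurable_const
  have h2 : Measurable fun y : (ℕ → ℝ × ℝ) × ℕ =>
      ∑ k ∈ Finset.range (y.2 + 1), (∏ j ∈ Finset.range k, (y.1 j).1) * (y.1 k).2 :=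
    measurable_from_prod_countable_left fun n => by dsimp only; fun_prop
  exact h2.comp (measurable_id.prodMk h1)

end Perpetuity

section StoppedSum

variable {Ω : Type*} {A B : ℕ → Ω → ℝ} {ω : Ω}

lemma prodA_succ (A : ℕ → Ω → ℝ) (n : ℕ) (ω : Ω) :
    prodA A (n + 1) ω = A 0 ω * ∏ j ∈ Finset.range n, A (j + 1) ω := by
  rw [prodA, Finset.prod_range_succ', mul_comm]

lemma exists_prodA_nonneg (h : ∃ k, A (k + 1) ω ≤ 0) : ∃ n, 1 ≤ n ∧ 0 ≤ prodA A n ω := by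
  by_contra! hcon
  obtain ⟨k, hk⟩ := h
  have h1 := hcon (k + 1) (by omega)
  have h2 := hcon (k + 2) (by omega)
  rw [prodA, Finset.prod_range_succ] at h2
  exact absurd (mul_nonneg_of_nonpos_of_nonpos h1.le hk) (not_le.2 h2)

/-- If `A₁ ≥ 0` the sum stops at once. Otherwise the sign of the products stays negative up to the
next nonpositive factor, and the sum collected until then is `A₁` times the perpetuity of the
shifted sequence. -/
lemma stoppedSum_eq (h : ∃ k, A (k + 1) ω ≤ 0) :
    stoppedSum A B ω = -(max (-A 0 ω) 0) * perpetuity (fun n => (A (n + 1) ω, B (n + 1) ω)) +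
      B 0 ω := by
  rcases le_or_gt 0 (A 0 ω) with h0 | h0
  · have : stopN A ω = 1 := by
      refine IsLeast.csInf_eq ⟨⟨le_rfl, ?_⟩, fun n hn => hn.1⟩
      simpa [prodA] using h0
    simp [stoppedSum, this, partialSum, prodA, max_eq_right (neg_nonpos.2 h0)]
  · set m := firstNonpos (fun n => (A (n + 1) ω, B (n + 1) ω)) with hm
    have hmem : A (m + 1) ω ≤ 0 := Nat.sInf_mem (s := {k | A (k + 1) ω ≤ 0}) h
    have hpos : ∀ j < m, 0 < A (j + 1) ω := fun j hj =>
      not_le.1 fun hle => Nat.notMem_of_lt_sInf (s := {k | A (k + 1) ω ≤ 0}) hj hle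
    have hneg : ∀ k ≤ m, prodA A (k + 1) ω < 0 := by
      intro k hk
      rw [prodA_succ]
      exact mul_neg_of_neg_of_pos h0 (Finset.prod_pos fun j hj =>
        hpos j ((Finset.mem_range.1 hj).trans_le hk))
    have : stopN A ω = m + 2 := by
      refine IsLeast.csInf_eq ⟨⟨by omega, ?_⟩, fun n hn => ?_⟩
      · rw [prodA, Finset.prod_range_succ]
        exact mul_nonneg_of_nonpos_of_nonpos (hneg m le_rfl).le hmem
      · by_contra! hlt
        obtain ⟨k, rfl⟩ : ∃ k, n = k + 1 := ⟨n - 1, by have := hn.1; omega⟩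
        exact absurd hn.2 (not_le.2 (hneg k (by omega)))
    rw [stoppedSum, this, partialSum, Finset.sum_range_succ', perpetuity, ← hm,
      max_eq_left (by linarith), neg_neg, Finset.mul_sum]
    simp only [prodA_succ, mul_assoc]
    simp [prodA]

end StoppedSum

section Law

/-- An event of probability less than one cannot occur at all times in an i.i.d. sequence. -/
lemma ae_exists_notMem_of_iid {Ω : Type*} [MeasurableSpace Ω] {P : Measure Ω} {X : Type*}
    [MeasurableSpace X] {ξ : ℕ → Ω → X}
    (hindep : iIndepFun ξ P) (hident : ∀ n, IdentDistrib (ξ n) (ξ 0) P P) {s : Set X}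
    (hs : MeasurableSet s) (h1 : P (ξ 0 ⁻¹' s) < 1) : ∀ᵐ ω ∂P, ∃ k, ξ k ω ∉ s := by
  rw [ae_iff]
  refine le_antisymm (ge_of_tendsto' (ENNReal.tendsto_pow_atTop_nhds_zero_of_lt_one h1)
    fun n => ?_) zero_le
  have h2 := hindep.measure_inter_preimage_eq_mul (Finset.range n) (sets := fun _ => s)
    fun _ _ => hs
  have h3 : ∀ i, P (ξ i ⁻¹' s) = P (ξ 0 ⁻¹' s) := fun i => (hident i).measure_mem_eq hs
  rw [Finset.prod_congr rfl (fun i _ => h3 i), Finset.prod_const, Finset.card_range] at h2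
  rw [← h2]
  refine measure_mono fun ω hω => ?_
  simp only [Set.mem_iInter]
  intro i _
  by_contra hi
  exact hω ⟨i, hi⟩

variable {Ω : Type*} [MeasurableSpace Ω] {P : Measure Ω} [IsProbabilityMeasure P]

/-- For an i.i.d. sequence the shifted sequence has the same law and is independent of the initial
term. -/
lemma map_zero_shift_eq_prod {X : Type*} [MeasurableSpace X] {ξ : ℕ → Ω → X}
    (hξ : ∀ n, Measurable (ξ n)) (hindep : iIndepFun ξ P)
    (hident : ∀ n, IdentDistrib (ξ n) (ξ 0) P P) :
    P.map (fun ω => (ξ 0 ω, fun n => ξ (n + 1) ω)) =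
      (P.map (ξ 0)).prod (P.map fun ω n => ξ n ω) := by
  have hind : IndepFun (ξ 0) (fun ω n => ξ (n + 1) ω) P := by
    refine IndepFun.indepFun_process (hξ 0) (fun n => hξ (n + 1)) fun J => ?_
    have := hindep.indepFun_finset {0} (J.image (· + 1)) (by simp) hξ
    refine this.comp (φ := fun f => f ⟨0, by simp⟩)
      (ψ := fun f (j : J) => f ⟨j + 1, by simp⟩) ?_ ?_
    · fun_prop
    · fun_prop
  have hs : P.map (fun ω n => ξ (n + 1) ω) = P.map (fun ω n => ξ n ω) := by
    rw [(hindep.precomp (g := fun n => n + 1) (add_left_injective 1)).map_fun_eq_infinitePi_map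
      (fun n => hξ (n + 1)), hindep.map_fun_eq_infinitePi_map hξ]
    congr 1
    funext n
    exact (hident (n + 1)).map_eq.trans (hident n).map_eq.symm
  rw [(indepFun_iff_map_prod_eq_prod_map_map (hξ 0).aemeasurable
    (measurable_pi_iff.2 fun n => hξ (n + 1)).aemeasurable).1 hind, hs]

lemma measurable_lawPos_fun :
    Measurable fun z : (ℝ × ℝ) × ℝ => max z.1.1 0 * z.2 + z.1.2 := by fun_prop

lemma measurable_lawNeg_fun :
    Measurable fun z : (ℝ × ℝ) × ℝ => -(max (-z.1.1) 0) * z.2 + z.1.2 := by fun_prop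

/-- The equation for the law of `S` contracts the total variation distance by the factor
`P(A > 0) < 1`, because it does not involve `S` where `A ≤ 0`. -/
lemma IsSolutionLaw.unique {μ : Measure (ℝ × ℝ)} [IsProbabilityMeasure μ]
    (hr : μ.real {z | 0 < z.1} < 1) {ν ν' : Measure ℝ} (h : IsSolutionLaw μ ν)
    (h' : IsSolutionLaw μ ν') : ν' = ν := by
  have key : ∀ {ν ν' : Measure ℝ}, IsSolutionLaw μ ν → IsSolutionLaw μ ν' →
      ∀ E : {E : Set ℝ // MeasurableSet E}, ν.real E.1 - ν'.real E.1 ≤ 0 := by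
    intro ν ν' h h'
    have := h.1
    have := h'.1
    have hset : MeasurableSet {z : ℝ × ℝ | 0 < z.1} :=
      measurableSet_lt measurable_const measurable_fst
    refine nonpos_of_self_improving measureReal_nonneg hr ?_ ?_
    · intro E
      have h1 : ν.real E.1 ≤ 1 := measureReal_le_one
      have h2 : 0 ≤ ν'.real E.1 := measureReal_nonneg
      linarith
    · rintro ρ hρ hle ⟨E, hE⟩
      set T := (fun z : (ℝ × ℝ) × ℝ => max z.1.1 0 * z.2 + z.1.2) ⁻¹' E with hT
      have hTm : MeasurableSet T := measurable_lawPos_fun hE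
      have e1 : ν.real E = (μ.prod ν).real T := by
        conv_lhs => rw [← h.2]
        exact map_measureReal_apply measurable_lawPos_fun hE
      have e2 : ν'.real E = (μ.prod ν').real T := by
        conv_lhs => rw [← h'.2]
        exact map_measureReal_apply measurable_lawPos_fun hE
      dsimp only
      rw [e1, e2, measureReal_prod_eq_integral ν hTm, measureReal_prod_eq_integral ν' hTm,
        ← integral_sub (integrable_measureReal_section ν hTm)
          (integrable_measureReal_section ν' hTm), ← smul_eq_mul, ← integral_indicator_const _ hset]
      refine integral_mono ((integrable_measureReal_section ν hTm).sub
        (integrable_measureReal_section ν' hTm)) ((integrable_const ρ).indicator hset) fun z => ?_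
      by_cases hz : 0 < z.1
      · have := hle ⟨Prod.mk z ⁻¹' T, measurable_prodMk_left hTm⟩
        simpa [Set.indicator, hz] using this
      · have h0 : max z.1 0 = 0 := max_eq_right (not_lt.1 hz)
        by_cases hv : z.2 ∈ E
        · have : Prod.mk z ⁻¹' T = Set.univ := by
            ext x; simp [hT, h0, hv]
          simp [this, Set.indicator, hz]
        · have : Prod.mk z ⁻¹' T = ∅ := by
            ext x; simp [hT, h0, hv]
          simp [this, Set.indicator, hz]
  have := h.1
  have := h'.1
  refine Measure.ext fun E hE => ?_
  have h1 := key h h' ⟨E, hE⟩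
  have h2 := key h' h ⟨E, hE⟩
  rw [← ENNReal.toReal_eq_toReal_iff' (measure_ne_top _ _) (measure_ne_top _ _)]
  exact le_antisymm (by simpa [measureReal_def] using h2) (by simpa [measureReal_def] using h1)

/-- The law of the perpetuity solves the equation for `S`, and determines the law of the stopped
sum. -/
lemma exists_isSolutionLaw_and_map_stoppedSum {A B : ℕ → Ω → ℝ} (hA : ∀ n, Measurable (A n))
    (hB : ∀ n, Measurable (B n)) (hindep : iIndepFun (fun n ω => (A n ω, B n ω)) P)
    (hident : ∀ n, IdentDistrib (fun ω => (A n ω, B n ω)) (fun ω => (A 0 ω, B 0 ω)) P P)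
    (h : ∀ᵐ ω ∂P, ∃ k, A (k + 1) ω ≤ 0) :
    ∃ ν : Measure ℝ, IsSolutionLaw (P.map fun ω => (A 0 ω, B 0 ω)) ν ∧
      AEMeasurable (stoppedSum A B) P ∧
      P.map (stoppedSum A B) = lawNeg (P.map fun ω => (A 0 ω, B 0 ω)) ν := by
  set ξ : ℕ → Ω → ℝ × ℝ := fun n ω => (A n ω, B n ω) with hξdef
  have hξ : ∀ n, Measurable (ξ n) := fun n => (hA n).prodMk (hB n)
  have hξω : Measurable fun ω n => ξ n ω := measurable_pi_iff.2 hξ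
  have hT : Measurable fun ω => perpetuity fun n => ξ n ω := measurable_perpetuity.comp hξω
  have hT' : Measurable fun ω => perpetuity fun n => ξ (n + 1) ω :=
    measurable_perpetuity.comp (measurable_pi_iff.2 fun n => hξ (n + 1))
  set ν := P.map fun ω => perpetuity fun n => ξ n ω with hν
  set μ := P.map (ξ 0) with hμ
  have hμp : IsProbabilityMeasure μ := Measure.isProbabilityMeasure_map (hξ 0).aemeasurable
  have hνp : IsProbabilityMeasure ν := Measure.isProbabilityMeasure_map hT.aemeasurable
  have hjoint : P.map (fun ω => (ξ 0 ω, perpetuity fun n => ξ (n + 1) ω)) = μ.prod ν := by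
    have h1 := congrArg (Measure.map (Prod.map id perpetuity))
      (map_zero_shift_eq_prod hξ hindep hident)
    have : IsProbabilityMeasure (P.map fun ω n => ξ n ω) :=
      Measure.isProbabilityMeasure_map hξω.aemeasurable
    rw [Measure.map_map (measurable_id.prodMap measurable_perpetuity)
      ((hξ 0).prodMk (measurable_pi_iff.2 fun n => hξ (n + 1))),
      ← Measure.map_prod_map _ _ measurable_id measurable_perpetuity, Measure.map_id,
      Measure.map_map measurable_perpetuity hξω] at h1
    exact h1
  have hRlaw : stoppedSum A B =ᵐ[P] (fun z : (ℝ × ℝ) × ℝ => -(max (-z.1.1) 0) * z.2 + z.1.2) ∘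
      fun ω => (ξ 0 ω, perpetuity fun n => ξ (n + 1) ω) := by
    filter_upwards [h] with ω hω
    exact stoppedSum_eq hω
  have hsol : (fun ω => perpetuity fun n => ξ n ω) =ᵐ[P]
      (fun z : (ℝ × ℝ) × ℝ => max z.1.1 0 * z.2 + z.1.2) ∘
        fun ω => (ξ 0 ω, perpetuity fun n => ξ (n + 1) ω) := by
    filter_upwards [h] with ω hω
    obtain ⟨k, hk⟩ := hω
    exact perpetuity_eq (x := fun n => ξ n ω) ⟨k + 1, hk⟩
  refine ⟨ν, ⟨hνp, ?_⟩, ?_, ?_⟩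
  · rw [lawPos, ← hjoint, Measure.map_map measurable_lawPos_fun ((hξ 0).prodMk hT'),
      ← Measure.map_congr hsol]
  · exact (measurable_lawNeg_fun.comp ((hξ 0).prodMk hT')).aemeasurable.congr hRlaw.symm
  · rw [lawNeg, ← hjoint, Measure.map_map measurable_lawNeg_fun ((hξ 0).prodMk hT'),
      ← Measure.map_congr hRlaw]

end Law

/-! ### Tails of the solution and of the stopped sum -/

section SolutionTails

/-- Passing from a normalization `t ^ (-α) L(t)` with `L` slowly varying to the normalization by
`P(|V| > t)`, which is monotone. -/
lemma isRegTail_of_tail_balance {Ω : Type*} [MeasurableSpace Ω] {P : Measure Ω}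
    [IsProbabilityMeasure P] {V : Ω → ℝ} (hV : Measurable V) {α p q : ℝ} {L : ℝ → ℝ}
    (hpq : p + q = 1) (hL : SlowlyVarying L)
    (hp : Tendsto (fun t => P.real {ω | t < V ω} / (t ^ (-α) * L t)) atTop (𝓝 p))
    (hq : Tendsto (fun t => P.real {ω | V ω < -t} / (t ^ (-α) * L t)) atTop (𝓝 q)) :
    Tendsto (fun t => P.real {ω | t < |V ω|} / (t ^ (-α) * L t)) atTop (𝓝 1) ∧
      IsRegTail (fun t => P.real {ω | t < |V ω|}) α := by
  set W : ℝ → ℝ := fun t => t ^ (-α) * L t with hW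
  set G : ℝ → ℝ := fun t => P.real {ω | t < |V ω|} with hGdef
  have hWpos : ∀ t, 0 < t → 0 < W t := fun t ht =>
    mul_pos (Real.rpow_pos_of_pos ht _) (hL.pos t ht)
  have hGW : Tendsto (fun t => G t / W t) atTop (𝓝 1) := by
    refine hpq ▸ (hp.add hq).congr' ?_
    filter_upwards [eventually_ge_atTop 0] with t ht
    rw [← add_div]
    congr 1
    rw [← measureReal_union _ (measurableSet_lt hV measurable_const)]
    · congr 1
      ext ω
      simp only [Set.mem_union, Set.mem_ofPred_eq, lt_abs]
      exact or_congr Iff.rfl lt_neg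
    · rw [Set.disjoint_left]
      intro ω (h1 : t < V ω) (h2 : V ω < -t)
      linarith
  have hanti : Antitone G := fun s t hst =>
    measureReal_mono fun ω (h : t < |V ω|) => hst.trans_lt h
  have hpos : ∀ t, 0 < G t := by
    intro t
    obtain ⟨s, hs1, hs2, hs3⟩ := ((hGW.eventually (lt_mem_nhds one_pos)).and
      ((eventually_ge_atTop t).and (eventually_gt_atTop 0))).exists
    have : 0 < G s := by
      have := (lt_div_iff₀ (hWpos s hs3)).1 hs1
      rwa [zero_mul] at this
    exact this.trans_le (hanti hs2)
  refine ⟨hGW, hanti, hpos, fun l hl => ?_⟩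
  have h1 : Tendsto (fun t => G (l * t) / W (l * t)) atTop (𝓝 1) :=
    hGW.comp (tendsto_id.const_mul_atTop hl)
  have h2 : Tendsto (fun t => W (l * t) / W t) atTop (𝓝 (l ^ (-α))) := by
    have h3 := (hL.tendsto l hl).const_mul (l ^ (-α))
    rw [Real.rpow_zero, mul_one] at h3
    refine h3.congr' ?_
    filter_upwards [eventually_gt_atTop 0] with t ht
    have h4 := (Real.rpow_pos_of_pos ht (-α)).ne'
    have h5 := (hL.pos t ht).ne'
    simp only [hW]
    rw [Real.mul_rpow hl.le ht.le]
    field_simp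
  have h6 := (h1.mul h2).div hGW one_ne_zero
  rw [one_mul, div_one] at h6
  refine h6.congr' ?_
  filter_upwards [eventually_gt_atTop 0] with t ht
  have h7 := (hWpos t ht).ne'
  have h8 := (hWpos (l * t) (by positivity)).ne'
  have h9 := (hpos t).ne'
  dsimp only [Pi.div_apply]
  field_simp

lemma map_neg_real_Ioi (ν : Measure ℝ) (t : ℝ) :
    (ν.map Neg.neg).real (Set.Ioi t) = ν.real (Set.Iio (-t)) := by
  rw [map_measureReal_apply measurable_neg measurableSet_Ioi]
  congr 1
  ext x
  simp

lemma map_neg_real_abs (ν : Measure ℝ) (t : ℝ) :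
    (ν.map Neg.neg).real {x | t < |x|} = ν.real {x | t < |x|} := by
  rw [map_measureReal_apply measurable_neg
    (measurableSet_lt measurable_const continuous_abs.measurable)]
  congr 1
  ext x
  simp

lemma measureReal_prod_map_neg {Ω : Type*} [MeasurableSpace Ω] {P : Measure Ω}
    [IsProbabilityMeasure P] (ν : Measure ℝ) [IsProbabilityMeasure ν] {s : Set (Ω × ℝ)}
    (hs : MeasurableSet s) :
    (P.prod (ν.map Neg.neg)).real s = (P.prod ν).real {z | (z.1, -z.2) ∈ s} := by
  conv_lhs => rw [← Measure.map_id (μ := P)]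
  rw [Measure.map_prod_map _ _ measurable_id measurable_neg,
    map_measureReal_apply (measurable_id.prodMap measurable_neg) hs]
  rfl

lemma IsSolutionLaw.real_Ioi {μ : Measure (ℝ × ℝ)} {ν : Measure ℝ} (h : IsSolutionLaw μ ν)
    (t : ℝ) :
    ν.real (Set.Ioi t) = (μ.prod ν).real {z | t < max z.1.1 0 * z.2 + z.1.2} := by
  conv_lhs => rw [← h.2]
  exact map_measureReal_apply measurable_lawPos_fun measurableSet_Ioi

lemma IsSolutionLaw.real_Iio {μ : Measure (ℝ × ℝ)} {ν : Measure ℝ} (h : IsSolutionLaw μ ν)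
    (t : ℝ) :
    ν.real (Set.Iio t) = (μ.prod ν).real {z | max z.1.1 0 * z.2 + z.1.2 < t} := by
  conv_lhs => rw [← h.2]
  exact map_measureReal_apply measurable_lawPos_fun measurableSet_Iio

variable {μ : Measure (ℝ × ℝ)} [IsProbabilityMeasure μ] {ν : Measure ℝ} {α β : ℝ}

lemma measurable_posPart_fst : Measurable fun z : ℝ × ℝ => max z.1 0 := by fun_prop

lemma measurable_negPart_fst : Measurable fun z : ℝ × ℝ => max (-z.1) 0 := by fun_prop

lemma integrable_rpow_of_le_abs {U : ℝ × ℝ → ℝ} (hU : Measurable U) (hU0 : ∀ z, 0 ≤ U z)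
    (hUle : ∀ z, U z ≤ |z.1|) {γ : ℝ} (hγ : 0 ≤ γ) (hγβ : γ ≤ β)
    (hint : Integrable (fun z : ℝ × ℝ => |z.1| ^ β) μ) :
    Integrable (fun z => U z ^ γ) μ := by
  refine Integrable.mono' ((integrable_const 1).add hint)
    (hU.pow_const γ).aestronglyMeasurable (ae_of_all _ fun z => ?_)
  rw [Real.norm_of_nonneg (Real.rpow_nonneg (hU0 z) _)]
  have h0 : 0 ≤ |z.1| ^ β := Real.rpow_nonneg (abs_nonneg _) _
  refine (Real.rpow_le_rpow (hU0 z) (hUle z) hγ).trans ?_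
  show _ ≤ 1 + |z.1| ^ β
  rcases le_total |z.1| 1 with h | h
  · have := Real.rpow_le_one (abs_nonneg _) h hγ
    linarith
  · have := Real.rpow_le_rpow_of_exponent_le h hγβ
    linarith

lemma posPart_le_abs (z : ℝ × ℝ) : max z.1 0 ≤ |z.1| := max_le (le_abs_self _) (abs_nonneg _)

lemma negPart_le_abs (z : ℝ × ℝ) : max (-z.1) 0 ≤ |z.1| :=
  max_le (neg_le_abs _) (abs_nonneg _)

lemma IsSolutionLaw.exists_tail_le (h : IsSolutionLaw μ ν)
    (hG : IsRegTail (fun t => μ.real {z | t < |z.2|}) α) (hα : 0 < α) (hαβ : α < β)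
    (hint : Integrable (fun z : ℝ × ℝ => |z.1| ^ β) μ) (hr : μ.real {z | 0 < z.1} < 1)
    (hm : ∫ z, max z.1 0 ^ α ∂μ < 1) :
    ∃ C, ∀ t, ν.real {x | t < |x|} ≤ C * μ.real {z | t < |z.2|} := by
  have := h.1
  have hU0 : ∀ z : ℝ × ℝ, 0 ≤ max z.1 0 := fun z => le_max_right _ _
  refine exists_tail_le_of_fixedPoint (P := μ) (U := fun z => max z.1 0) (V := fun z => z.2)
    (G := fun t => μ.real {z | t < |z.2|}) hG hα hαβ measurable_posPart_fst hU0
    (integrable_rpow_of_le_abs measurable_posPart_fst hU0 posPart_le_abs (by linarith) le_rfl hint)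
    measurable_snd (fun _ => rfl) (by simpa using hr) hm fun t => ?_
  have e : ν.real {x | t < |x|} =
      (μ.prod ν).real {z | t < |max z.1.1 0 * z.2 + z.1.2|} := by
    conv_lhs => rw [← h.2]
    exact map_measureReal_apply measurable_lawPos_fun
      (measurableSet_lt measurable_const continuous_abs.measurable)
  rw [e]
  refine measureReal_mono ?_
  intro z (hz : t < |max z.1.1 0 * z.2 + z.1.2|)
  refine hz.trans_le ((abs_add_le _ _).trans (le_of_eq ?_))
  rw [abs_mul, abs_of_nonneg (hU0 z.1)]

lemma IsSolutionLaw.tendsto_right_tail (h : IsSolutionLaw μ ν)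
    (hG : IsRegTail (fun t => μ.real {z | t < |z.2|}) α) (hα : 0 < α) (hαβ : α < β)
    (hint : Integrable (fun z : ℝ × ℝ => |z.1| ^ β) μ) (hr : μ.real {z | 0 < z.1} < 1)
    (hm : ∫ z, max z.1 0 ^ α ∂μ < 1) {p : ℝ}
    (hp : Tendsto (fun t => μ.real {z | t < z.2} / μ.real {z | t < |z.2|}) atTop (𝓝 p)) :
    Tendsto (fun t => ν.real (Set.Ioi t) / μ.real {z | t < |z.2|}) atTop
      (𝓝 (p / (1 - ∫ z, max z.1 0 ^ α ∂μ))) := by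
  have := h.1
  obtain ⟨C, hC⟩ := h.exists_tail_le hG hα hαβ hint hr hm
  have hU0 : ∀ z : ℝ × ℝ, 0 ≤ max z.1 0 := fun z => le_max_right _ _
  exact tendsto_tail_of_fixedPoint hG hα hαβ measurable_posPart_fst hU0
    (integrable_rpow_of_le_abs measurable_posPart_fst hU0 posPart_le_abs (by linarith) le_rfl hint)
    measurable_snd hm hC hp h.real_Ioi

/-- The left tail of `S` is the right tail of `-S`, which solves the equation for `(A, -B)`. -/
lemma IsSolutionLaw.tendsto_left_tail (h : IsSolutionLaw μ ν)
    (hG : IsRegTail (fun t => μ.real {z | t < |z.2|}) α) (hα : 0 < α) (hαβ : α < β)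
    (hint : Integrable (fun z : ℝ × ℝ => |z.1| ^ β) μ) (hr : μ.real {z | 0 < z.1} < 1)
    (hm : ∫ z, max z.1 0 ^ α ∂μ < 1) {q : ℝ}
    (hq : Tendsto (fun t => μ.real {z | z.2 < -t} / μ.real {z | t < |z.2|}) atTop (𝓝 q)) :
    Tendsto (fun t => ν.real (Set.Iio (-t)) / μ.real {z | t < |z.2|}) atTop
      (𝓝 (q / (1 - ∫ z, max z.1 0 ^ α ∂μ))) := by
  have := h.1
  obtain ⟨C, hC⟩ := h.exists_tail_le hG hα hαβ hint hr hm
  have hU0 : ∀ z : ℝ × ℝ, 0 ≤ max z.1 0 := fun z => le_max_right _ _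
  have : IsProbabilityMeasure (ν.map Neg.neg) :=
    Measure.isProbabilityMeasure_map measurable_neg.aemeasurable
  simp_rw [← map_neg_real_Ioi ν]
  refine tendsto_tail_of_fixedPoint (V := fun z => -z.2) (C := C) hG hα hαβ measurable_posPart_fst
    hU0 (integrable_rpow_of_le_abs measurable_posPart_fst hU0 posPart_le_abs (by linarith) le_rfl
      hint) measurable_snd.neg hm (fun t => (map_neg_real_abs ν t).trans_le (hC t)) ?_ fun t => ?_
  · simpa only [lt_neg] using hq
  · rw [map_neg_real_Ioi, h.real_Iio,
      measureReal_prod_map_neg ν (s := {z : (ℝ × ℝ) × ℝ | t < max z.1.1 0 * z.2 + -z.1.2})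
        (measurableSet_lt_mul_add measurable_posPart_fst measurable_snd.neg t)]
    congr 1
    ext z
    simp only [Set.mem_ofPred_eq]
    constructor <;> intro hz <;> linarith

lemma integral_posPart_add_negPart (hα : 0 < α) (hαβ : α < β)
    (hint : Integrable (fun z : ℝ × ℝ => |z.1| ^ β) μ) :
    ∫ z, max z.1 0 ^ α ∂μ + ∫ z, max (-z.1) 0 ^ α ∂μ = ∫ z, |z.1| ^ α ∂μ := by
  rw [← integral_add
    (integrable_rpow_of_le_abs measurable_posPart_fst (fun _ => le_max_right _ _) posPart_le_abs
      hα.le hαβ.le hint)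
    (integrable_rpow_of_le_abs measurable_negPart_fst (fun _ => le_max_right _ _) negPart_le_abs
      hα.le hαβ.le hint)]
  refine integral_congr_ae (ae_of_all _ fun z => ?_)
  dsimp only
  rcases le_total 0 z.1 with h | h
  · rw [max_eq_left h, max_eq_right (neg_nonpos.2 h), Real.zero_rpow hα.ne', add_zero,
      abs_of_nonneg h]
  · rw [max_eq_right h, max_eq_left (neg_nonneg.2 h), Real.zero_rpow hα.ne', zero_add,
      abs_of_nonpos h]

/-- In `-A₋ S + B` a large positive value arises from `-S` or from `B`, and the constants
`q E[A₋ ^ α] / (1 - μ₊)` and `p` add up to one when `E[A₋ ^ α] = 1 - μ₊`. -/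
lemma IsSolutionLaw.tendsto_lawNeg_right_tail (h : IsSolutionLaw μ ν)
    (hG : IsRegTail (fun t => μ.real {z | t < |z.2|}) α) (hα : 0 < α) (hαβ : α < β)
    (hint : Integrable (fun z : ℝ × ℝ => |z.1| ^ β) μ) (hr : μ.real {z | 0 < z.1} < 1)
    (hm : ∫ z, max z.1 0 ^ α ∂μ < 1) (h1 : ∫ z, |z.1| ^ α ∂μ = 1) {p q : ℝ} (hpq : p + q = 1)
    (hp : Tendsto (fun t => μ.real {z | t < z.2} / μ.real {z | t < |z.2|}) atTop (𝓝 p))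
    (hq : Tendsto (fun t => μ.real {z | z.2 < -t} / μ.real {z | t < |z.2|}) atTop (𝓝 q)) :
    Tendsto (fun t => (lawNeg μ ν).real (Set.Ioi t) / μ.real {z | t < |z.2|}) atTop (𝓝 1) := by
  have := h.1
  obtain ⟨C, hC⟩ := h.exists_tail_le hG hα hαβ hint hr hm
  have hU0 : ∀ z : ℝ × ℝ, 0 ≤ max (-z.1) 0 := fun z => le_max_right _ _
  have : IsProbabilityMeasure (ν.map Neg.neg) :=
    Measure.isProbabilityMeasure_map measurable_neg.aemeasurable
  have ht := h.tendsto_left_tail hG hα hαβ hint hr hm hq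
  simp_rw [← map_neg_real_Ioi ν] at ht
  have key := tendsto_step hG hα hαβ measurable_negPart_fst hU0
    (integrable_rpow_of_le_abs measurable_negPart_fst hU0 negPart_le_abs (by linarith) le_rfl hint)
    measurable_snd (fun t => (map_neg_real_abs ν t).trans_le (hC t)) ht hp
  have hsum := integral_posPart_add_negPart hα hαβ hint
  rw [h1] at hsum
  have hconst : q / (1 - ∫ z, max z.1 0 ^ α ∂μ) * ∫ z, max (-z.1) 0 ^ α ∂μ + p = 1 := by
    rw [← eq_sub_iff_add_eq'.2 hsum, div_mul_cancel₀ _ (by linarith)]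
    linarith
  rw [hconst] at key
  refine key.congr fun t => ?_
  congr 1
  rw [measureReal_prod_map_neg ν
      (measurableSet_lt_mul_add measurable_negPart_fst measurable_snd t), lawNeg,
    map_measureReal_apply measurable_lawNeg_fun measurableSet_Ioi]
  congr 1
  ext z
  simp

lemma IsSolutionLaw.tendsto_lawNeg_left_tail (h : IsSolutionLaw μ ν)
    (hG : IsRegTail (fun t => μ.real {z | t < |z.2|}) α) (hα : 0 < α) (hαβ : α < β)
    (hint : Integrable (fun z : ℝ × ℝ => |z.1| ^ β) μ) (hr : μ.real {z | 0 < z.1} < 1)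
    (hm : ∫ z, max z.1 0 ^ α ∂μ < 1) (h1 : ∫ z, |z.1| ^ α ∂μ = 1) {p q : ℝ} (hpq : p + q = 1)
    (hp : Tendsto (fun t => μ.real {z | t < z.2} / μ.real {z | t < |z.2|}) atTop (𝓝 p))
    (hq : Tendsto (fun t => μ.real {z | z.2 < -t} / μ.real {z | t < |z.2|}) atTop (𝓝 q)) :
    Tendsto (fun t => (lawNeg μ ν).real (Set.Iio (-t)) / μ.real {z | t < |z.2|}) atTop (𝓝 1) := by
  have := h.1
  obtain ⟨C, hC⟩ := h.exists_tail_le hG hα hαβ hint hr hm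
  have hU0 : ∀ z : ℝ × ℝ, 0 ≤ max (-z.1) 0 := fun z => le_max_right _ _
  have ht := h.tendsto_right_tail hG hα hαβ hint hr hm hp
  have key := tendsto_step (V := fun z => -z.2) hG hα hαβ measurable_negPart_fst hU0
    (integrable_rpow_of_le_abs measurable_negPart_fst hU0 negPart_le_abs (by linarith) le_rfl hint)
    measurable_snd.neg hC ht (by simpa only [lt_neg] using hq)
  have hsum := integral_posPart_add_negPart hα hαβ hint
  rw [h1] at hsum
  have hconst : p / (1 - ∫ z, max z.1 0 ^ α ∂μ) * ∫ z, max (-z.1) 0 ^ α ∂μ + q = 1 := by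
    rw [← eq_sub_iff_add_eq'.2 hsum, div_mul_cancel₀ _ (by linarith), hpq]
  rw [hconst] at key
  refine key.congr fun t => ?_
  congr 1
  rw [lawNeg, map_measureReal_apply measurable_lawNeg_fun measurableSet_Iio]
  congr 1
  ext z
  simp only [Set.mem_ofPred_eq, Set.mem_preimage, Set.mem_Iio]
  constructor <;> intro hz <;> linarith

end SolutionTails

/-! ### The stopped sum and the solution of the equation for `S` -/

theorem mainTheorem9 {Ω : Type*} [MeasurableSpace Ω] (P : Measure Ω) [IsProbabilityMeasure P]
    (A B : ℕ → Ω → ℝ) (hA : ∀ n, Measurable (A n)) (hB : ∀ n, Measurable (B n))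
    (hindep : iIndepFun (fun n ω => (A n ω, B n ω)) P)
    (hident : ∀ n, IdentDistrib (fun ω => (A n ω, B n ω)) (fun ω => (A 0 ω, B 0 ω)) P P)
    (hneg : 0 < P {ω | A 0 ω < 0}) :
    -- the stopping time is almost surely finite
    (∀ᵐ ω ∂P, ∃ n, 1 ≤ n ∧ 0 ≤ prodA A n ω) ∧
    ∃ ν : Measure ℝ,
      -- `ν`, the law of `S`, is the one and only law solving the equation for `S`
      IsSolutionLaw (P.map (fun ω => (A 0 ω, B 0 ω))) ν ∧
      (∀ ν', IsSolutionLaw (P.map (fun ω => (A 0 ω, B 0 ω))) ν' → ν' = ν) ∧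
      -- (i)
      P.map (stoppedSum A B) = lawNeg (P.map (fun ω => (A 0 ω, B 0 ω))) ν ∧
      -- (ii)
      ∀ (α ε p q : ℝ) (L : ℝ → ℝ), 0 < α → 0 < ε → 0 ≤ p → 0 ≤ q → p + q = 1 →
        SlowlyVarying L →
        Tendsto (fun t => P.real {ω | t < B 0 ω} / (t ^ (-α) * L t)) atTop (𝓝 p) →
        Tendsto (fun t => P.real {ω | B 0 ω < -t} / (t ^ (-α) * L t)) atTop (𝓝 q) →
        Integrable (fun ω => |A 0 ω| ^ (α + ε)) P →
        muPlus P (A 0) α < 1 →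
          -- the tails of `S`
          Tendsto (fun t => ν.real (Set.Ioi t) / (t ^ (-α) * L t)) atTop
            (𝓝 (p / (1 - muPlus P (A 0) α))) ∧
          Tendsto (fun t => ν.real (Set.Iio (-t)) / (t ^ (-α) * L t)) atTop
            (𝓝 (q / (1 - muPlus P (A 0) α))) ∧
          (0 < p → (fun t => ν.real (Set.Ioi t)) ~[atTop]
            (fun t => 1 / (1 - muPlus P (A 0) α) * P.real {ω | t < B 0 ω})) ∧
          (0 < q → (fun t => ν.real (Set.Iio (-t))) ~[atTop]
            (fun t => 1 / (1 - muPlus P (A 0) α) * P.real {ω | B 0 ω < -t})) ∧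
          -- the tails of the stopped sum
          ((∫ ω, |A 0 ω| ^ α ∂P) = 1 →
            (fun t => P.real {ω | t < stoppedSum A B ω}) ~[atTop]
              (fun t => P.real {ω | t < |B 0 ω|}) ∧
            (fun t => P.real {ω | t < |B 0 ω|}) ~[atTop]
              (fun t => P.real {ω | stoppedSum A B ω < -t})) := by
  set μ := P.map (fun ω => (A 0 ω, B 0 ω)) with hμ
  have h0 : Measurable fun ω => (A 0 ω, B 0 ω) := (hA 0).prodMk (hB 0)
  have hμp : IsProbabilityMeasure μ := Measure.isProbabilityMeasure_map h0.aemeasurable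
  have hposm : MeasurableSet {z : ℝ × ℝ | 0 < z.1} :=
    measurableSet_lt measurable_const measurable_fst
  have hlt : P {ω | 0 < A 0 ω} < 1 := by
    have hc : MeasurableSet {ω | 0 < A 0 ω} := measurableSet_lt measurable_const (hA 0)
    refine lt_of_le_of_ne prob_le_one fun h => hneg.ne' ?_
    refine measure_mono_null (fun ω (hω : A 0 ω < 0) => ?_) ((prob_compl_eq_zero_iff hc).2 h)
    exact not_lt.2 hω.le
  have hr : μ.real {z | 0 < z.1} < 1 := by
    rw [hμ, map_measureReal_apply h0 hposm, measureReal_def]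
    exact (ENNReal.toReal_lt_toReal (measure_ne_top _ _) ENNReal.one_ne_top).2 hlt
  have hhit : ∀ᵐ ω ∂P, ∃ k, A (k + 1) ω ≤ 0 := by
    have := ae_exists_notMem_of_iid (hindep.precomp (g := fun n => n + 1) (add_left_injective 1))
      (fun n => (hident (n + 1)).trans (hident 1).symm) hposm
      (by rw [(hident 1).measure_mem_eq hposm]; exact hlt)
    simpa using this
  refine ⟨hhit.mono fun ω => exists_prodA_nonneg, ?_⟩
  obtain ⟨ν, hν, hRm, hRlaw⟩ :=
    exists_isSolutionLaw_and_map_stoppedSum hA hB hindep hident hhit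
  refine ⟨ν, hν, fun ν' hν' => hν.unique hr hν', hRlaw, ?_⟩
  intro α ε p q L hα hε hp0 hq0 hpq hL hp hq hint hm
  have hαβ : α < α + ε := by linarith
  have hright : ∀ t, P.real {ω | t < B 0 ω} = μ.real {z | t < z.2} := fun t =>
    (map_measureReal_apply h0 (measurableSet_lt measurable_const measurable_snd)).symm
  have hleft : ∀ t, P.real {ω | B 0 ω < -t} = μ.real {z | z.2 < -t} := fun t =>
    (map_measureReal_apply h0 (measurableSet_lt measurable_snd measurable_const)).symm
  have habs : ∀ t, P.real {ω | t < |B 0 ω|} = μ.real {z | t < |z.2|} := fun t =>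
    (map_measureReal_apply h0 (measurableSet_lt measurable_const measurable_snd.abs)).symm
  have hintμ : Integrable (fun z : ℝ × ℝ => |z.1| ^ (α + ε)) μ :=
    (integrable_map_measure
      (measurable_fst.abs.pow_const _).aestronglyMeasurable h0.aemeasurable).2 hint
  have hmean : ∫ ω, |A 0 ω| ^ α ∂P = ∫ z, |z.1| ^ α ∂μ :=
    (integral_map h0.aemeasurable
      (measurable_fst.abs.pow_const _).aestronglyMeasurable).symm
  have hmu : muPlus P (A 0) α = ∫ z, max z.1 0 ^ α ∂μ := by
    rw [muPlus, ← integral_indicator (measurableSet_lt measurable_const (hA 0)),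
      hμ, integral_map h0.aemeasurable (measurable_posPart_fst.pow_const _).aestronglyMeasurable]
    refine integral_congr_ae (ae_of_all _ fun ω => ?_)
    by_cases h : 0 < A 0 ω
    · simp [Set.indicator, h, max_eq_left h.le]
    · simp [Set.indicator, h, max_eq_right (not_lt.1 h), Real.zero_rpow hα.ne']
  rw [hmu] at hm ⊢
  rw [hmean]
  simp_rw [hright, hleft, habs] at hp hq ⊢
  have hsR : ∀ t, P.real {ω | t < stoppedSum A B ω} = (lawNeg μ ν).real (Set.Ioi t) := fun t => by
    rw [← hRlaw, map_measureReal_apply_of_aemeasurable hRm measurableSet_Ioi]; rfl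
  have hsL : ∀ t, P.real {ω | stoppedSum A B ω < -t} = (lawNeg μ ν).real (Set.Iio (-t)) :=
    fun t => by
      rw [← hRlaw, map_measureReal_apply_of_aemeasurable hRm measurableSet_Iio]; rfl
  simp_rw [hsR, hsL]
  obtain ⟨hGW, hG⟩ := isRegTail_of_tail_balance (P := μ) measurable_snd hpq hL hp hq
  have hWpos : ∀ᶠ t in atTop, 0 < t ^ (-α) * L t := by
    filter_upwards [eventually_gt_atTop 0] with t ht
    exact mul_pos (Real.rpow_pos_of_pos ht _) (hL.pos t ht)
  -- the normalizations `t ^ (-α) L(t)` and `P(|B| > t)` are interchangeable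
  have toG : ∀ {f : ℝ → ℝ} {c : ℝ}, Tendsto (fun t => f t / (t ^ (-α) * L t)) atTop (𝓝 c) →
      Tendsto (fun t => f t / μ.real {z | t < |z.2|}) atTop (𝓝 c) := by
    intro f c hf
    have := hf.div hGW one_ne_zero
    rw [div_one] at this
    refine this.congr' ?_
    filter_upwards [hWpos] with t ht
    exact div_div_div_cancel_right₀ ht.ne' _ _
  have ofG : ∀ {f : ℝ → ℝ} {c : ℝ}, Tendsto (fun t => f t / μ.real {z | t < |z.2|}) atTop (𝓝 c) →
      Tendsto (fun t => f t / (t ^ (-α) * L t)) atTop (𝓝 c) := by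
    intro f c hf
    have := hf.mul hGW
    rw [mul_one] at this
    exact this.congr fun t => div_mul_div_cancel₀ (hG.pos t).ne'
  have hpG := toG hp
  have hqG := toG hq
  have hR := hν.tendsto_right_tail hG hα hαβ hintμ hr hm hpG
  have hL' := hν.tendsto_left_tail hG hα hαβ hintμ hr hm hqG
  set m := ∫ z, max z.1 0 ^ α ∂μ
  have equiv : ∀ {f g : ℝ → ℝ} {c : ℝ}, 0 < c →
      Tendsto (fun t => f t / μ.real {z | t < |z.2|}) atTop (𝓝 (c / (1 - m))) →
      Tendsto (fun t => g t / μ.real {z | t < |z.2|}) atTop (𝓝 c) →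
      f ~[atTop] fun t => 1 / (1 - m) * g t := by
    intro f g c hc hf hg
    refine isEquivalent_of_tendsto_one ?_
    have h1m : 0 < 1 - m := by linarith
    have h2 := hf.div (hg.const_mul (1 / (1 - m))) (by positivity)
    have h3 : c / (1 - m) / (1 / (1 - m) * c) = 1 := by field_simp
    rw [h3] at h2
    refine h2.congr fun t => ?_
    have := (hG.pos t).ne'
    simp only [Pi.div_apply]
    rw [← mul_div_assoc, div_div_div_cancel_right₀ this]
  refine ⟨ofG hR, ofG hL', fun hp' => equiv hp' hR hpG, fun hq' => equiv hq' hL' hqG, fun h1 => ?_⟩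
  refine ⟨isEquivalent_of_tendsto_one ?_, (isEquivalent_of_tendsto_one ?_).symm⟩
  · exact hν.tendsto_lawNeg_right_tail hG hα hαβ hintμ hr hm h1 hpq hpG hqG
  · exact hν.tendsto_lawNeg_left_tail hG hα hαβ hintμ hr hm h1 hpq hpG hqG
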